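/- An \emph{implicative algebra} is a tuple $\mathbb A=(A,\le,\to,\Sigma)$ where $(A,\le)$ is a complete lattice; $\to\colon A\times A\to A$ is antitone in the first and monotone in the second argument and satisfies $a\to\bigwedge_{i\in I}b_i=\bigwedge_{i\in I}(a\to b_i)$ for all families (including the empty one); and $\Sigma\subseteq A$ is upward closed, contains $b$ whenever it contains $a\to b$ and $a$, and contains $\bigwedge_{a,b}(a\to(b\to a))$ and $\bigwedge_{a,b,c}((a\to(b\to c))\to((a\to b)\to(a\to c)))$. Put $$a\times b:=\bigwedge_{x\in A}\big((a\to(b\to x))\to x\big),\qquad a+b:=\bigwedge_{x\in A}\big((a\to x)\to((b\to x)\to x)\big),$$ $$\mathop{\forall}_{i\in I}a_i:=\bigwedge_{i\in I}a_i,\qquad \mathop{\exists}_{i\in I}a_i:=\bigwedge_{x\in A}\Big(\bigwedge_{i\in I}(a_i\to x)\to x\Big).$$ Let $\kappa$ be a strongly inaccessible cardinal. For a set $A$ let $W_0=\emptyset$, $W_{\beta+1}=\mathrm{Part}(W_\beta,A)$ (the set of partial functions from $W_\beta$ to $A$), $W_\lambda=\bigcup_{\beta<\lambda}W_\beta$ for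 limit $\lambda$, and $\mathbf W=W^A_\kappa:=W_\kappa$; write $\partial_0(\alpha)$ for the domain of $\alpha\in\mathbf W$. Given an implicative algebra $\mathbb A$ on $A$, define by simultaneous recursion on rank $$\alpha\in_{\mathbf W}\beta:=\mathop{\exists}_{t\in\partial_0(\beta)}\big(\beta(t)\times t=_{\mathbf W}\alpha\big),\qquad \alpha=_{\mathbf W}\beta:=\mathop{\forall}_{t\in\partial_0(\alpha)}\big(\alpha(t)\to t\in_{\mathbf W}\beta\big)\times\mathop{\forall}_{t\in\partial_0(\beta)}\big(\beta(t)\to t\in_{\mathbf W}\alpha\big).$$ For a formula in context $\varphi[x_1,\dots,x_n]$ of the language $\{\in,=\}$ let $\|\varphi\|\colon\mathbf W^n\to A$ be obtained by interpreting $\in,=,\bot,\wedge,\vee,\to$ by $\in_{\mathbf W},=_{\mathbf W},\bot,\times,+,\to$, and the quantifiers by $\mathop{\forall}$ and $\mathop{\exists}$ indexed by $\mathbf W$. \textbf{(1)} If $|A|<\kappa$, then $\|\psi\|\in\Sigma$ for each of the following axioms $\psi$ of $\mathbf{IZF}$, where $\varphi$ ranges over all formulas in the indicated contexts, for all $n\ge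 0$, and $\underline w=w_1,\dots,w_n$: \begin{itemize} \item Empty set: $\exists x\,\forall y\in x\,\bot$; \item Extensionality: $\forall x\forall y\,(x\subseteq y\wedge y\subseteq x\to x=y)$; \item Pair: $\forall x\forall y\exists z\,(x\in z\wedge y\in z)$; \item Union: $\forall x\exists u\,\forall y\in x\,\forall z\in y\,(z\in u)$; \item Power set: $\forall x\exists z\forall y\,(y\subseteq x\to y\in z)$; \item Infinity: $\exists u\,\big(\exists x\in u\,\forall y\in x\,\bot\ \wedge\ \forall x\in u\,\exists y\in u\,(x\subseteq y\wedge x\in y\wedge\forall z\in y\,(z\in x\vee z=x))\big)$; \item Separation: $\forall \underline w\,\forall x\exists y\,\big(\forall z\in y\,(z\in x\wedge\varphi)\wedge\forall z\in x\,(\varphi\to z\in y)\big)$, for $\varphi[\underline w,x,z]$; \item Collection: $\forall \underline w\,\forall y\,\big(\forall x\in y\,\exists z\,\varphi\to\exists u\,\forall x\in y\,\exists z\in u\,\varphi\big)$, for $\varphi[\underline w,x,y,z]$; \item $\in$-Induction: $\forall \underline w\,\big(\forall x\,(\forall y\in x\,\varphi[y/x]\to\varphi)\to\forall x\,\varphi\big)$,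 for $\varphi[\underline w,x]$. \end{itemize} \textbf{(2)} (Heyting-valued models.) If $H$ is a complete Heyting algebra with $|H|<\kappa$, then for the implicative algebra $(H,\le,\Rightarrow,\{\top\})$ and every formula in context, $\|\varphi\|\colon\mathbf W^n\to H$ equals the usual Heyting-valued interpretation, given by $[\![x\in y]\!]=\bigvee_{t\in\partial_0(y)}(y(t)\wedge[\![x=t]\!])$, $[\![x=y]\!]=\bigwedge_{t\in\partial_0(x)}(x(t)\Rightarrow[\![t\in y]\!])\wedge\bigwedge_{t\in\partial_0(y)}(y(t)\Rightarrow[\![t\in x]\!])$ and the Heyting operations, with $\bigwedge,\bigvee$ over $\mathbf W$ for the quantifiers. \textbf{(3)} (Realizability models.) Let $(R,\cdot)$ be a total combinatory algebra with $|\mathcal P(R)|<\kappa$, let $k,s$ be its combinators, $\bar k=k(skk)$, $r_0=r\cdot k$ and $r_1=r\cdot\bar k$, and consider the implicative algebra $(\mathcal P(R),\subseteq,\Rightarrow,\mathcal P(R)\setminus\{\emptyset\})$ with $X\Rightarrow Y=\{r\mid r\cdot a\in Y\text{ for all }a\in X\}$. Let $V=V_\kappa$, where $V_0=\emptyset$,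 $V_{\beta+1}=\mathcal P(V_\beta\times R)$, with unions at limits, and let $r\Vdash\varphi$ be the realizability relation over $V$: $r\Vdash x\in y$ iff there is $(t,r_0)\in y$ with $r_1\Vdash x=t$; $r\Vdash x=y$ iff $r_0a\Vdash t\in y$ for all $(t,a)\in x$ and $r_1a\Vdash t\in x$ for all $(t,a)\in y$; nothing realizes $\bot$; $r\Vdash\varphi\wedge\psi$ iff $r_0\Vdash\varphi$ and $r_1\Vdash\psi$; $r\Vdash\varphi\vee\psi$ iff ($r_0=k$ and $r_1\Vdash\varphi$) or ($r_0=\bar k$ and $r_1\Vdash\psi$); $r\Vdash\varphi\to\psi$ iff $ra\Vdash\psi$ whenever $a\Vdash\varphi$; $r\Vdash\exists x\,\varphi$ (resp. $\forall x\,\varphi$) iff $r\Vdash\varphi(v)$ for some (resp. every) $v\in V$. Then there is a surjection $T\colon\mathbf W\to V$ with $T(f)=\{(T(t),r)\mid t\in\partial_0(f),\ r\in f(t)\}$ for all $f\in\mathbf W$, such that for every formula in context $\varphi[x_1,\dots,x_n]$ both $$\bigcap_{\underline\alpha\in\mathbf W^n}\big(\|\varphi\|(\underline\alpha)\Rightarrow\{r\mid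 r\Vdash\varphi(T\underline\alpha)\}\big)\quad\text{and}\quad\bigcap_{\underline\alpha\in\mathbf W^n}\big(\{r\mid r\Vdash\varphi(T\underline\alpha)\}\Rightarrow\|\varphi\|(\underline\alpha)\big)$$ are non-empty. -/

import Mathlib

open Cardinal

universe u v

/-! ### Implicative algebras -/

/-- An implicative algebra on a complete lattice `A`: an implication together with a separator. -/
structure ImplicativeAlgebra (A : Type u) [CompleteLattice A] where
  /-- The implication `a → b`. -/
  imp : A → A → A
  imp_mono : ∀ {a a' b b' : A}, a' ≤ a → b ≤ b' → imp a b ≤ imp a' b'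
  imp_sInf : ∀ (a : A) (B : Set A), imp a (sInf B) = ⨅ b ∈ B, imp a b
  /-- The separator `Σ`. -/
  sep : Set A
  sep_upward : ∀ {a b : A}, a ∈ sep → a ≤ b → b ∈ sep
  sep_mp : ∀ {a b : A}, imp a b ∈ sep → a ∈ sep → b ∈ sep
  sep_K : (⨅ (a : A) (b : A), imp a (imp b a)) ∈ sep
  sep_S : (⨅ (a : A) (b : A) (c : A),
    imp (imp a (imp b c)) (imp (imp a b) (imp a c))) ∈ sep

namespace ImplicativeAlgebra

variable {A : Type u} [CompleteLattice A] (𝔸 : ImplicativeAlgebra A)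

/-- The product `a × b`. -/
def times (a b : A) : A := ⨅ x : A, 𝔸.imp (𝔸.imp a (𝔸.imp b x)) x

/-- The sum `a + b`. -/
def plus (a b : A) : A := ⨅ x : A, 𝔸.imp (𝔸.imp a x) (𝔸.imp (𝔸.imp b x) x)

/-- The existential quantifier of an indexed family (the universal one is `⨅ i, a i`). -/
def exist {I : Type v} (a : I → A) : A := ⨅ x : A, 𝔸.imp (⨅ i, 𝔸.imp (a i) x) x

end ImplicativeAlgebra

/-! ### Hereditary sets of labelled elements

`Name A` is the ambient universe in which the hierarchies are built: up to extensional equality, an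
element is a small set of pairs `(t, a)` with `t : Name A` and `a : A`. It is built as Mathlib
builds `ZFSet` from `PSet`. -/

/-- Codes for hereditary sets of elements labelled by `A`. -/
inductive PreName (A : Type u) : Type (u + 1)
  | mk (ι : Type u) (t : ι → PreName A) (a : ι → A) : PreName A

namespace PreName

variable {A : Type u}

/-- Extensional equality: the same (labelled) elements, hereditarily. -/
def Equiv : PreName A → PreName A → Prop
  | mk ι t a, mk ι' t' a' =>
    (∀ i : ι, ∃ j : ι', Equiv (t i) (t' j) ∧ a i = a' j) ∧
      (∀ j : ι', ∃ i : ι, Equiv (t i) (t' j) ∧ a i = a' j)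

theorem Equiv.refl : ∀ x : PreName A, Equiv x x
  | mk _ t _ => ⟨fun i => ⟨i, Equiv.refl (t i), rfl⟩, fun i => ⟨i, Equiv.refl (t i), rfl⟩⟩

theorem Equiv.symm : ∀ {x y : PreName A}, Equiv x y → Equiv y x
  | mk _ _ _, mk _ _ _, ⟨h₁, h₂⟩ =>
    ⟨fun j => let ⟨i, h, e⟩ := h₂ j; ⟨i, h.symm, e.symm⟩,
      fun i => let ⟨j, h, e⟩ := h₁ i; ⟨j, h.symm, e.symm⟩⟩

theorem Equiv.trans : ∀ {x y z : PreName A}, Equiv x y → Equiv y z → Equiv x z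
  | mk _ _ _, mk _ _ _, mk _ _ _, ⟨h₁, h₂⟩, ⟨h₃, h₄⟩ =>
    ⟨fun i =>
        let ⟨j, h, e⟩ := h₁ i
        let ⟨k, h', e'⟩ := h₃ j
        ⟨k, h.trans h', e.trans e'⟩,
      fun k =>
        let ⟨j, h', e'⟩ := h₄ k
        let ⟨i, h, e⟩ := h₂ j
        ⟨i, h.trans h', e.trans e'⟩⟩

instance setoid (A : Type u) : Setoid (PreName A) :=
  ⟨Equiv, ⟨Equiv.refl, Equiv.symm, Equiv.trans⟩⟩

end PreName

/-- Hereditary (small) sets of elements labelled by `A`. -/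
def Name (A : Type u) : Type (u + 1) := Quotient (PreName.setoid A)

namespace Name

variable {A : Type u}

/-- The set of pairs `(t, a)` that constitutes a name. For a name that is a partial function this
is its graph. -/
def graph (x : Name A) : Set (Name A × A) :=
  Quotient.lift (s := PreName.setoid A)
    (fun x : PreName A => match x with
      | .mk ι t a => {p : Name A × A | ∃ i : ι, p = (Quotient.mk (PreName.setoid A) (t i), a i)})
    (by
      rintro ⟨ι, t, a⟩ ⟨ι', t', a'⟩ ⟨h₁, h₂⟩
      ext p
      constructor
      · rintro ⟨i, rfl⟩
        obtain ⟨j, h, e⟩ := h₁ i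
        exact ⟨j, Prod.ext (Quotient.sound h) e⟩
      · rintro ⟨j, rfl⟩
        obtain ⟨i, h, e⟩ := h₂ j
        exact ⟨i, Prod.ext (Quotient.sound h).symm e.symm⟩) x

/-- `t` is in the domain of `x`. -/
def InDom (t x : Name A) : Prop := ∃ a : A, (t, a) ∈ x.graph

theorem inDom_wf : WellFounded (InDom : Name A → Name A → Prop) := by
  have key : ∀ x : PreName A, Acc (InDom : Name A → Name A → Prop)
      (Quotient.mk (PreName.setoid A) x) := by
    intro x
    induction x with
    | mk ι t a ih =>
      constructor
      rintro y ⟨b, i, hi⟩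
      have hy : y = Quotient.mk (PreName.setoid A) (t i) := congrArg Prod.fst hi
      rw [hy]
      exact ih i
  exact ⟨fun x => Quotient.inductionOn x key⟩

/-- Recursion on unordered pairs of names: one entry may be replaced by an element of its domain. -/
instance : WellFoundedRelation (Sym2 (Name A)) :=
  ⟨Sym2.GameAdd InDom, inDom_wf.sym2_gameAdd⟩

theorem decr_left {x : Name A} (y : Name A) (p : x.graph) :
    WellFoundedRelation.rel s(p.1.1, y) s(x, y) :=
  Sym2.GameAdd.fst (rα := InDom) ⟨p.1.2, p.2⟩

theorem decr_right (x : Name A) {y : Name A} (p : y.graph) :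
    WellFoundedRelation.rel s(x, p.1.1) s(x, y) :=
  Sym2.GameAdd.snd (rα := InDom) ⟨p.1.2, p.2⟩

/-- `Part(X, A)`: the partial functions from `X` to `A`, each identified with its graph. -/
def part (X : Set (Name A)) : Set (Name A) :=
  {f | (∀ t a, (t, a) ∈ f.graph → t ∈ X) ∧
    ∀ t a b, (t, a) ∈ f.graph → (t, b) ∈ f.graph → a = b}

/-- The sets of pairs `(t, a)` with `t ∈ X` and `a : A`. -/
def pow (X : Set (Name A)) : Set (Name A) :=
  {f | ∀ t a, (t, a) ∈ f.graph → t ∈ X}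

/-- The cumulative hierarchy obtained by iterating `F`: empty at `0`, apply `F` at successors,
unions at limits. -/
noncomputable def hierarchy (F : Set (Name A) → Set (Name A)) (α : Ordinal.{u}) : Set (Name A) :=
  Ordinal.limitRecOn α ∅ (fun _ X => F X) (fun α _ X => ⋃ (β : Ordinal.{u}) (h : β < α), X β h)

end Name

/-- The universe `W = W_κ` of the hierarchy `W_0 = ∅`, `W_{β+1} = Part(W_β, A)`, with unions at
limits. -/
def W (A : Type u) (κ : Cardinal.{u}) : Type (u + 1) :=
  {x : Name A // x ∈ Name.hierarchy Name.part κ.ord}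

/-! ### The language of set theory and the axioms of IZF -/

/-- Formulas in context `[x_0, …, x_{n-1}]`. A quantifier binds the last variable `x_n` of the
extended context. -/
inductive Fml : ℕ → Type
  | bot {n : ℕ} : Fml n
  | mem {n : ℕ} (i j : Fin n) : Fml n
  | eq {n : ℕ} (i j : Fin n) : Fml n
  | and {n : ℕ} (φ ψ : Fml n) : Fml n
  | or {n : ℕ} (φ ψ : Fml n) : Fml n
  | imp {n : ℕ} (φ ψ : Fml n) : Fml n
  | ex {n : ℕ} (φ : Fml (n + 1)) : Fml n
  | all {n : ℕ} (φ : Fml (n + 1)) : Fml n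

namespace Fml

/-- Substitution of the variables `x_{f i}` for the variables `x_i`. -/
def rename : {n m : ℕ} → (Fin n → Fin m) → Fml n → Fml m
  | _, _, _, bot => bot
  | _, _, f, mem i j => mem (f i) (f j)
  | _, _, f, eq i j => eq (f i) (f j)
  | _, _, f, and φ ψ => and (rename f φ) (rename f ψ)
  | _, _, f, or φ ψ => or (rename f φ) (rename f ψ)
  | _, _, f, imp φ ψ => imp (rename f φ) (rename f ψ)
  | _, m, f, ex φ => ex (rename (Fin.snoc (fun i => (f i).castSucc) (Fin.last m)) φ)
  | _, m, f, all φ => all (rename (Fin.snoc (fun i => (f i).castSucc) (Fin.last m)) φ)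

/-- Universal closure. -/
def close : {n : ℕ} → Fml n → Fml 0
  | 0, φ => φ
  | _ + 1, φ => close (all φ)

/-- `∀ x_n ∈ x_j, φ`. -/
def ball {n : ℕ} (j : Fin n) (φ : Fml (n + 1)) : Fml n :=
  all (imp (mem (Fin.last n) j.castSucc) φ)

/-- `∃ x_n ∈ x_j, φ`. -/
def bex {n : ℕ} (j : Fin n) (φ : Fml (n + 1)) : Fml n :=
  ex (and (mem (Fin.last n) j.castSucc) φ)

/-- `x_i ⊆ x_j`. -/
def sub {n : ℕ} (i j : Fin n) : Fml n := ball i (mem (Fin.last n) j.castSucc)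

/-- `∃ x, ∀ y ∈ x, ⊥`. -/
def emptyAx : Fml 0 := ex (ball 0 bot)

/-- `∀ x y, (x ⊆ y ∧ y ⊆ x → x = y)`. -/
def extAx : Fml 0 := all (all (imp (and (sub 0 1) (sub 1 0)) (eq 0 1)))

/-- `∀ x y, ∃ z, (x ∈ z ∧ y ∈ z)`. -/
def pairAx : Fml 0 := all (all (ex (and (mem 0 2) (mem 1 2))))

/-- `∀ x, ∃ u, ∀ y ∈ x, ∀ z ∈ y, z ∈ u`. -/
def unionAx : Fml 0 := all (ex (ball 0 (ball 2 (mem 3 1))))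

/-- `∀ x, ∃ z, ∀ y, (y ⊆ x → y ∈ z)`. -/
def powAx : Fml 0 := all (ex (all (imp (sub 2 0) (mem 2 1))))

/-- `∃ u, (∃ x ∈ u, ∀ y ∈ x, ⊥) ∧
  ∀ x ∈ u, ∃ y ∈ u, (x ⊆ y ∧ x ∈ y ∧ ∀ z ∈ y, (z ∈ x ∨ z = x))`. -/
def infAx : Fml 0 :=
  ex (and (bex 0 (ball 1 bot))
    (ball 0 (bex 0 (and (sub 1 2) (and (mem 1 2) (ball 2 (or (mem 3 1) (eq 3 1))))))))

/-- For `φ` in context `[w_1, …, w_n, x, z]`: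
`∀ w_1 … w_n, ∀ x, ∃ y, ((∀ z ∈ y, (z ∈ x ∧ φ)) ∧ ∀ z ∈ x, (φ → z ∈ y))`. -/
def sepAx {n : ℕ} (φ : Fml (n + 2)) : Fml 0 :=
  let w : Fin n → Fin (n + 3) := Fin.castAdd 3
  let x : Fin (n + 3) := ⟨n, by omega⟩
  let y : Fin (n + 3) := ⟨n + 1, by omega⟩
  let z : Fin (n + 3) := ⟨n + 2, by omega⟩
  let φ' : Fml (n + 3) := rename (Fin.snoc (α := fun _ => Fin (n + 3))
    (Fin.snoc (α := fun _ => Fin (n + 3)) w x) z) φ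
  close (n := n) (all (ex (and
    (ball (n := n + 2) ⟨n + 1, by omega⟩ (and (mem z x) φ'))
    (ball (n := n + 2) ⟨n, by omega⟩ (imp φ' (mem z y))))))

/-- For `φ` in context `[w_1, …, w_n, x, y, z]`:
`∀ w_1 … w_n, ∀ y, ((∀ x ∈ y, ∃ z, φ) → ∃ u, ∀ x ∈ y, ∃ z ∈ u, φ)`. -/
def colAx {n : ℕ} (φ : Fml (n + 3)) : Fml 0 :=
  -- `φ` in the context `[w, y, x, z]`
  let φ₁ : Fml (n + 3) := rename (Fin.snoc (α := fun _ => Fin (n + 3))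
    (Fin.snoc (α := fun _ => Fin (n + 3)) (Fin.snoc (α := fun _ => Fin (n + 3))
      (Fin.castAdd 3) ⟨n + 1, by omega⟩) ⟨n, by omega⟩) ⟨n + 2, by omega⟩) φ
  -- `φ` in the context `[w, y, u, x, z]`
  let φ₂ : Fml (n + 4) := rename (Fin.snoc (α := fun _ => Fin (n + 4))
    (Fin.snoc (α := fun _ => Fin (n + 4)) (Fin.snoc (α := fun _ => Fin (n + 4))
      (Fin.castAdd 4) ⟨n + 2, by omega⟩) ⟨n, by omega⟩) ⟨n + 3, by omega⟩) φ
  close (n := n) (all (imp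
    (ball (n := n + 1) ⟨n, by omega⟩ (ex φ₁))
    (ex (ball (n := n + 2) ⟨n, by omega⟩ (bex (n := n + 3) ⟨n + 1, by omega⟩ φ₂)))))

/-- For `φ` in context `[w_1, …, w_n, x]`:
`∀ w_1 … w_n, ((∀ x, (∀ y ∈ x, φ[y/x]) → φ) → ∀ x, φ)`. -/
def indAx {n : ℕ} (φ : Fml (n + 1)) : Fml 0 :=
  let φ' : Fml (n + 2) := rename (Fin.snoc (α := fun _ => Fin (n + 2))
    (Fin.castAdd 2) ⟨n + 1, by omega⟩) φ
  close (n := n) (imp (all (imp (ball (n := n + 1) ⟨n, by omega⟩ φ') φ)) (all φ))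

end Fml

/-- The axioms of IZF. -/
inductive IZFAxiom : Fml 0 → Prop
  | empty : IZFAxiom Fml.emptyAx
  | ext : IZFAxiom Fml.extAx
  | pair : IZFAxiom Fml.pairAx
  | union : IZFAxiom Fml.unionAx
  | pow : IZFAxiom Fml.powAx
  | inf : IZFAxiom Fml.infAx
  | sep {n : ℕ} (φ : Fml (n + 2)) : IZFAxiom (Fml.sepAx φ)
  | col {n : ℕ} (φ : Fml (n + 3)) : IZFAxiom (Fml.colAx φ)
  | ind {n : ℕ} (φ : Fml (n + 1)) : IZFAxiom (Fml.indAx φ)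

/-! ### The implicative-valued interpretation -/

namespace ImplicativeAlgebra

variable {A : Type u} [CompleteLattice A] (𝔸 : ImplicativeAlgebra A)

/- In the recursive clauses, quantification over `t` in the domain of a partial function `x`
is quantification over the pairs `p = (t, x(t))` of its graph. -/
mutual

/-- `x ∈_W y := ∃_{t ∈ dom y} (y(t) × t =_W x)`. -/
noncomputable def memW (x y : Name A) : A :=
  𝔸.exist fun p : y.graph => 𝔸.times p.1.2 (eqW p.1.1 x)
termination_by s(x, y)
decreasing_by
  rw [Sym2.eq_swap]
  exact Name.decr_right x p

/-- `x =_W y := (x ⊆_W y) × (y ⊆_W x)`, where `x ⊆_W y := ∀_{t ∈ dom x} (x(t) → t ∈_W y)`. -/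
noncomputable def eqW (x y : Name A) : A :=
  𝔸.times (⨅ p : x.graph, 𝔸.imp p.1.2 (memW p.1.1 y))
    (⨅ p : y.graph, 𝔸.imp p.1.2 (memW p.1.1 x))
termination_by s(x, y)
decreasing_by
  · exact Name.decr_left y p
  · rw [Sym2.eq_swap]
    exact Name.decr_right x p

end

/-- The interpretation `‖φ [x_0, …, x_{n-1}]‖ : W^n → A`. -/
noncomputable def interp (κ : Cardinal.{u}) : {n : ℕ} → Fml n → (Fin n → W A κ) → A
  | _, .bot, _ => ⊥
  | _, .mem i j, α => 𝔸.memW (α i).1 (α j).1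
  | _, .eq i j, α => 𝔸.eqW (α i).1 (α j).1
  | _, .and φ ψ, α => 𝔸.times (interp κ φ α) (interp κ ψ α)
  | _, .or φ ψ, α => 𝔸.plus (interp κ φ α) (interp κ ψ α)
  | _, .imp φ ψ, α => 𝔸.imp (interp κ φ α) (interp κ ψ α)
  | _, .ex φ, α => 𝔸.exist fun β : W A κ => interp κ φ (Fin.snoc (α := fun _ => W A κ) α β)
  | _, .all φ, α => ⨅ β : W A κ, interp κ φ (Fin.snoc (α := fun _ => W A κ) α β)

end ImplicativeAlgebra

/-! ### Heyting-valued models -/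

/-- The implicative algebra `(H, ≤, ⇨, {⊤})` of a complete Heyting algebra `H`. -/
def heytingImplicative (H : Type u) [Order.Frame H] : ImplicativeAlgebra H where
  imp a b := a ⇨ b
  imp_mono h h' := himp_le_himp h h'
  imp_sInf a B := by simp only [sInf_eq_iInf, himp_iInf_eq]
  sep := {⊤}
  sep_upward := by
    rintro a b rfl h
    exact top_le_iff.mp h
  sep_mp := by
    rintro a b h rfl
    simpa using h
  sep_K := by simp
  sep_S := by
    simp only [Set.mem_singleton_iff, iInf_eq_top]
    intro a b c
    rw [himp_eq_top_iff, le_himp_iff, le_himp_iff]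
    have h₁ : (a ⇨ b ⇨ c) ⊓ (a ⇨ b) ⊓ a ≤ b :=
      le_trans (le_inf (inf_le_left.trans inf_le_right) inf_le_right) himp_inf_le
    have h₂ : (a ⇨ b ⇨ c) ⊓ (a ⇨ b) ⊓ a ≤ b ⇨ c :=
      le_trans (le_inf (inf_le_left.trans inf_le_left) inf_le_right) himp_inf_le
    exact le_trans (le_inf h₂ h₁) himp_inf_le

namespace HeytingValued

variable {H : Type u} [Order.Frame H]

mutual

/-- `⟦x ∈ y⟧ = ⋁_{t ∈ dom y} (y(t) ∧ ⟦x = t⟧)`. -/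
noncomputable def mem (x y : Name H) : H := ⨆ p : y.graph, p.1.2 ⊓ eq x p.1.1
termination_by s(x, y)
decreasing_by exact Name.decr_right x p

/-- `⟦x = y⟧ = ⋀_{t ∈ dom x} (x(t) ⇨ ⟦t ∈ y⟧) ∧ ⋀_{t ∈ dom y} (y(t) ⇨ ⟦t ∈ x⟧)`. -/
noncomputable def eq (x y : Name H) : H :=
  (⨅ p : x.graph, p.1.2 ⇨ mem p.1.1 y) ⊓ ⨅ p : y.graph, p.1.2 ⇨ mem p.1.1 x
termination_by s(x, y)
decreasing_by
  · exact Name.decr_left y p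
  · rw [Sym2.eq_swap]
    exact Name.decr_right x p

end

/-- The Heyting-valued interpretation of formulas. -/
noncomputable def interp (κ : Cardinal.{u}) : {n : ℕ} → Fml n → (Fin n → W H κ) → H
  | _, .bot, _ => ⊥
  | _, .mem i j, α => mem (α i).1 (α j).1
  | _, .eq i j, α => eq (α i).1 (α j).1
  | _, .and φ ψ, α => interp κ φ α ⊓ interp κ ψ α
  | _, .or φ ψ, α => interp κ φ α ⊔ interp κ ψ α
  | _, .imp φ ψ, α => interp κ φ α ⇨ interp κ ψ α
  | _, .ex φ, α => ⨆ β : W H κ, interp κ φ (Fin.snoc (α := fun _ => W H κ) α β)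
  | _, .all φ, α => ⨅ β : W H κ, interp κ φ (Fin.snoc (α := fun _ => W H κ) α β)

end HeytingValued

/-! ### Realizability models -/

/-- A total combinatory algebra. -/
class CombinatoryAlgebra (R : Type u) where
  app : R → R → R
  k : R
  s : R
  app_k : ∀ a b : R, app (app k a) b = a
  app_s : ∀ a b c : R, app (app (app s a) b) c = app (app a c) (app b c)

namespace CombinatoryAlgebra

variable {R : Type u} [CombinatoryAlgebra R]

/-- The combinator `λ x y. y`. -/
def kbar : R := app k (app (app s k) k)

/-- The first component of `r`, coded as a pair. -/
def fst (r : R) : R := app r k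

/-- The second component of `r`, coded as a pair. -/
def snd (r : R) : R := app r kbar

end CombinatoryAlgebra

open CombinatoryAlgebra in
/-- The implicative algebra `(𝒫(R), ⊆, ⇒, 𝒫(R) ∖ {∅})` of a total combinatory algebra `R`, with
`X ⇒ Y = {r | r · a ∈ Y for all a ∈ X}`. -/
def realizabilityImplicative (R : Type u) [CombinatoryAlgebra R] : ImplicativeAlgebra (Set R) where
  imp X Y := {r | ∀ a ∈ X, app r a ∈ Y}
  imp_mono h h' := fun _ hr a ha => h' (hr a (h ha))
  imp_sInf X B := by
    ext r
    simp only [Set.sInf_eq_sInter, Set.mem_sInter, Set.mem_ofPred_eq, Set.iInf_eq_iInter,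
      Set.mem_iInter]
    exact ⟨fun h b hb a ha => h a ha b hb, fun h a ha b hb => h b hb a ha⟩
  sep := {X | X ≠ ∅}
  sep_upward := by
    intro X Y hX h
    exact (Set.Nonempty.mono h (Set.nonempty_iff_ne_empty.mpr hX)).ne_empty
  sep_mp := by
    intro X Y h hX
    obtain ⟨r, hr⟩ := Set.nonempty_iff_ne_empty.mpr h
    obtain ⟨a, ha⟩ := Set.nonempty_iff_ne_empty.mpr hX
    exact Set.Nonempty.ne_empty ⟨_, hr a ha⟩
  sep_K := by
    refine Set.Nonempty.ne_empty ⟨k, ?_⟩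
    simp only [Set.iInf_eq_iInter, Set.mem_iInter, Set.mem_ofPred_eq]
    intro X Y a ha b _
    rwa [app_k]
  sep_S := by
    refine Set.Nonempty.ne_empty ⟨s, ?_⟩
    simp only [Set.iInf_eq_iInter, Set.mem_iInter, Set.mem_ofPred_eq]
    intro X Y Z f hf g hg a ha
    rw [app_s]
    exact hf a ha _ (hg a ha)

namespace Realizability

open CombinatoryAlgebra

/-- The realizability universe `V_κ` of the hierarchy `V_0 = ∅`, `V_{β+1} = 𝒫(V_β × R)`, with
unions at limits. -/
def V (R : Type u) (κ : Cardinal.{u}) : Type (u + 1) :=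
  {x : Name R // x ∈ Name.hierarchy Name.pow κ.ord}

variable {R : Type u} [CombinatoryAlgebra R]

mutual

/-- The realizers of `x ∈ y`: those `r` such that for some `t` the pair `(t, r₀)` belongs to `y`
and `r₁` realizes `x = t`. -/
noncomputable def mem (x y : Name R) : Set R :=
  {r | ∃ p : y.graph, fst r = p.1.2 ∧ snd r ∈ eq x p.1.1}
termination_by s(x, y)
decreasing_by exact Name.decr_right x p

/-- The realizers of `x = y`: those `r` such that `r₀ · a` realizes `t ∈ y` for every `(t, a)` in
`x`, and `r₁ · a` realizes `t ∈ x` for every `(t, a)` in `y`. -/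
noncomputable def eq (x y : Name R) : Set R :=
  {r | (∀ p : x.graph, app (fst r) p.1.2 ∈ mem p.1.1 y) ∧
    ∀ p : y.graph, app (snd r) p.1.2 ∈ mem p.1.1 x}
termination_by s(x, y)
decreasing_by
  · exact Name.decr_left y p
  · rw [Sym2.eq_swap]
    exact Name.decr_right x p

end

/-- The set of realizers of a formula. -/
noncomputable def interp (κ : Cardinal.{u}) : {n : ℕ} → Fml n → (Fin n → V R κ) → Set R
  | _, .bot, _ => ∅
  | _, .mem i j, α => mem (α i).1 (α j).1
  | _, .eq i j, α => eq (α i).1 (α j).1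
  | _, .and φ ψ, α => {r | fst r ∈ interp κ φ α ∧ snd r ∈ interp κ ψ α}
  | _, .or φ ψ, α =>
    {r | (fst r = k ∧ snd r ∈ interp κ φ α) ∨ (fst r = kbar ∧ snd r ∈ interp κ ψ α)}
  | _, .imp φ ψ, α => {r | ∀ a ∈ interp κ φ α, app r a ∈ interp κ ψ α}
  | _, .ex φ, α => {r | ∃ β : V R κ, r ∈ interp κ φ (Fin.snoc (α := fun _ => V R κ) α β)}
  | _, .all φ, α => {r | ∀ β : V R κ, r ∈ interp κ φ (Fin.snoc (α := fun _ => V R κ) α β)}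

end Realizability

/-!
An implicative algebra carries an application `a b`, the least `c` with `a ≤ b → c`, and an
abstraction `λ f = ⋀ a, (a → f a)`, with `(λ f) a ≤ f a`. A lambda term is thus an element of the
lattice, `t ≤ φ` says that `t` realizes `φ`, and the typing rules of a system with intersections
hold for `≤` (`lam_le`, `app_le`, and the rules for the connectives). Since the separator contains
`K` and `S` and is closed under application, every closed term belongs to it
(`mem_sep_of_tracked`). To prove `⋀ i, φ i ∈ Σ` it is therefore enough to give one closed term that
lies below all `φ i`; a fixed-point combinator realizes recursion on the rank of names
(`fix_le_of_inDom`).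

With these tools reflexivity, symmetry and transitivity of `=_W` and substitution in formulas
(`exists_subst`) have realizers that are uniform in the names. For the axioms of IZF one then needs
sets: a partial function with fewer than `κ` arguments in `W` is in `W` as `κ` is regular
(`W.exists_graph`), and conversely every element of `W` has fewer than `κ` arguments as `κ` is a
strong limit above `|A|` (`W.exists_range_eq`). Most sets carry the constant value `⊤`. A
subset cut out by a formula carries truth values as values, and so do the members of a power set and
the successor of a name. Collection chooses, for every `t` in the domain and every truth value
`a : A`, one witness whose value is `a`, if there is one.

For a complete Heyting algebra the second-order encodings of `∧`, `∨`, `∃` equal the lattice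
operations, which gives the second claim by recursion on names and formulas. For a combinatory
algebra the lambda calculus is applied to the algebra of sets of realizers: coded pairs and
labelled realizers are equivalent to the encodings by single realizers, and one recursion on names
(`exists_eq_equiv`) compares the two interpretations of equality along the map `Name.collapse`,
which is onto because a set of pairs is the collapse of a partial function defined on chosen
preimages.
-/

/-! ### A lambda calculus in an implicative algebra -/

namespace ImplicativeAlgebra

variable {A : Type u} [CompleteLattice A] (𝔸 : ImplicativeAlgebra A)

/-- Application: the least `c` with `a ≤ b → c`. -/
def app (a b : A) : A := sInf {c | a ≤ 𝔸.imp b c}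

/-- Abstraction: the meet of all `a → f a`. -/
def lam (f : A → A) : A := ⨅ a, 𝔸.imp a (f a)

variable {𝔸}

theorem le_imp_app (a b : A) : a ≤ 𝔸.imp b (𝔸.app a b) := by
  rw [app, 𝔸.imp_sInf]
  exact le_iInf₂ fun c hc => hc

theorem app_le {t u a b : A} (ht : t ≤ 𝔸.imp a b) (hu : u ≤ a) : 𝔸.app t u ≤ b :=
  sInf_le (ht.trans (𝔸.imp_mono hu le_rfl))

theorem app_le_iff {a b c : A} : 𝔸.app a b ≤ c ↔ a ≤ 𝔸.imp b c :=
  ⟨fun h => (le_imp_app a b).trans (𝔸.imp_mono le_rfl h), fun h => app_le h le_rfl⟩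

theorem app_mono {a a' b b' : A} (h : a ≤ a') (h' : b ≤ b') : 𝔸.app a b ≤ 𝔸.app a' b' :=
  app_le (h.trans (le_imp_app a' b')) h'

theorem lam_le {f : A → A} {a b : A} (h : ∀ x, x ≤ a → f x ≤ b) : 𝔸.lam f ≤ 𝔸.imp a b :=
  (iInf_le _ a).trans (𝔸.imp_mono le_rfl (h a le_rfl))

theorem beta (f : A → A) (a : A) : 𝔸.app (𝔸.lam f) a ≤ f a :=
  app_le_iff.2 (iInf_le _ a)

theorem app_mem_sep {a b : A} (ha : a ∈ 𝔸.sep) (hb : b ∈ 𝔸.sep) : 𝔸.app a b ∈ 𝔸.sep :=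
  𝔸.sep_mp (𝔸.sep_upward ha (le_imp_app a b)) hb

/-! ### Closed terms belong to the separator -/

variable (A) in
/-- Environments of length `n`, the most recently bound variable last. -/
@[reducible] def Env : ℕ → Type u
  | 0 => PUnit
  | n + 1 => Env n × A

variable (𝔸) in
/-- Application of `c` to all entries of an environment. -/
def apps (c : A) : {n : ℕ} → Env A n → A
  | 0, _ => c
  | _ + 1, v => 𝔸.app (apps c v.1) v.2

variable (𝔸) in
/-- `f` is tracked if a single element of the separator, applied to the entries of the environment,
lies below the value of `f`. Stated as a class so that instance search runs through the syntax of
lambda terms. -/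
class Tracked {n : ℕ} (f : Env A n → A) : Prop where
  out : ∃ c ∈ 𝔸.sep, ∀ v, 𝔸.apps c v ≤ f v

variable (𝔸) in
/-- The combinator `K`. -/
def kTm : A := ⨅ (a : A) (b : A), 𝔸.imp a (𝔸.imp b a)

variable (𝔸) in
/-- The combinator `S`. -/
def sTm : A := ⨅ (a : A) (b : A) (c : A),
  𝔸.imp (𝔸.imp a (𝔸.imp b c)) (𝔸.imp (𝔸.imp a b) (𝔸.imp a c))

theorem kTm_app (a b : A) : 𝔸.app (𝔸.app 𝔸.kTm a) b ≤ a :=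
  app_le_iff.2 (app_le_iff.2 ((iInf_le _ a).trans (iInf_le _ b)))

theorem sTm_app (a b c : A) :
    𝔸.app (𝔸.app (𝔸.app 𝔸.sTm a) b) c ≤ 𝔸.app (𝔸.app a c) (𝔸.app b c) := by
  have h : 𝔸.sTm ≤ 𝔸.imp (𝔸.imp c (𝔸.imp (𝔸.app b c) (𝔸.app (𝔸.app a c) (𝔸.app b c))))
      (𝔸.imp (𝔸.imp c (𝔸.app b c)) (𝔸.imp c (𝔸.app (𝔸.app a c) (𝔸.app b c)))) :=
    (iInf_le _ c).trans ((iInf_le _ (𝔸.app b c)).trans (iInf_le _ _))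
  refine app_le (app_le (app_le h ?_) ?_) le_rfl
  · exact app_le_iff.1 (app_le_iff.1 le_rfl)
  · exact app_le_iff.1 le_rfl

theorem exists_apps_const (n : ℕ) {c : A} (hc : c ∈ 𝔸.sep) :
    ∃ d ∈ 𝔸.sep, ∀ v : Env A n, 𝔸.apps d v ≤ c := by
  induction n generalizing c with
  | zero => exact ⟨c, hc, fun _ => le_rfl⟩
  | succ n ih =>
    obtain ⟨d, hd, h⟩ := ih (app_mem_sep 𝔸.sep_K hc)
    exact ⟨d, hd, fun v => (app_mono (h v.1) le_rfl).trans (kTm_app c v.2)⟩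

/-- For one more variable, `S` distributes it over the application, and the two applications
of `S` are then covered by the shorter environment. -/
theorem exists_apps_app (n : ℕ) {c d : A} (hc : c ∈ 𝔸.sep) (hd : d ∈ 𝔸.sep) :
    ∃ e ∈ 𝔸.sep, ∀ v : Env A n, 𝔸.apps e v ≤ 𝔸.app (𝔸.apps c v) (𝔸.apps d v) := by
  induction n generalizing c d with
  | zero => exact ⟨_, app_mem_sep hc hd, fun _ => le_rfl⟩
  | succ n ih =>
    obtain ⟨s, hs, h⟩ := exists_apps_const n 𝔸.sep_S
    obtain ⟨e₁, he₁, h₁⟩ := ih hs hc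
    obtain ⟨e, he, h₂⟩ := ih he₁ hd
    refine ⟨e, he, fun v => ?_⟩
    refine le_trans (app_mono ((h₂ v.1).trans (app_mono ((h₁ v.1).trans
      (app_mono (h v.1) le_rfl)) le_rfl)) le_rfl) (sTm_app _ _ _)

namespace Tracked

instance const {n : ℕ} (c : A) [hc : Fact (c ∈ 𝔸.sep)] : Tracked 𝔸 (fun _ : Env A n => c) :=
  ⟨exists_apps_const n hc.out⟩

instance app {n : ℕ} (f g : Env A n → A) [hf : Tracked 𝔸 f] [hg : Tracked 𝔸 g] :
    Tracked 𝔸 (fun v => 𝔸.app (f v) (g v)) := by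
  obtain ⟨c, hc, h⟩ := hf.out
  obtain ⟨d, hd, h'⟩ := hg.out
  obtain ⟨e, he, h''⟩ := exists_apps_app n hc hd
  exact ⟨e, he, fun v => (h'' v).trans (app_mono (h v) (h' v))⟩

instance lam {n : ℕ} (f : Env A n → A → A)
    [hf : Tracked 𝔸 (n := n + 1) (fun v => f v.1 v.2)] : Tracked 𝔸 (fun v => 𝔸.lam (f v)) := by
  obtain ⟨c, hc, h⟩ := hf.out
  exact ⟨c, hc, fun v => le_iInf fun a => app_le_iff.1 (h (v, a))⟩

theorem weaken {n : ℕ} (f : Env A n → A) [hf : Tracked 𝔸 f] :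
    Tracked 𝔸 (n := n + 1) (fun v => f v.1) := by
  obtain ⟨c, hc, h⟩ := hf.out
  obtain ⟨d, hd, h'⟩ := exists_apps_const n 𝔸.sep_K
  obtain ⟨e, he, h''⟩ := exists_apps_app n hd hc
  exact ⟨e, he, fun v => (app_mono ((h'' v.1).trans (app_mono (h' v.1) (h v.1))) le_rfl).trans
    (kTm_app _ _)⟩

instance var₀ {n : ℕ} : Tracked 𝔸 (n := n + 1) (fun v => v.2) := by
  obtain ⟨e, he, h⟩ := exists_apps_const n
    (app_mem_sep (app_mem_sep 𝔸.sep_S 𝔸.sep_K) 𝔸.sep_K)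
  exact ⟨e, he, fun v => (app_mono (h v.1) le_rfl).trans ((sTm_app _ _ _).trans (kTm_app _ _))⟩

instance var₁ {n : ℕ} : Tracked 𝔸 (n := n + 1 + 1) (fun v => v.1.2) := weaken _
instance var₂ {n : ℕ} : Tracked 𝔸 (n := n + 1 + 1 + 1) (fun v => v.1.1.2) :=
  weaken (n := n + 1 + 1) fun v => v.1.2
instance var₃ {n : ℕ} : Tracked 𝔸 (n := n + 1 + 1 + 1 + 1) (fun v => v.1.1.1.2) :=
  weaken (n := n + 1 + 1 + 1) fun v => v.1.1.2
instance var₄ {n : ℕ} : Tracked 𝔸 (n := n + 1 + 1 + 1 + 1 + 1) (fun v => v.1.1.1.1.2) :=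
  weaken (n := n + 1 + 1 + 1 + 1) fun v => v.1.1.1.2
instance var₅ {n : ℕ} : Tracked 𝔸 (n := n + 1 + 1 + 1 + 1 + 1 + 1) (fun v => v.1.1.1.1.1.2) :=
  weaken (n := n + 1 + 1 + 1 + 1 + 1) fun v => v.1.1.1.1.2

end Tracked

/-- A lambda term all of whose constants belong to the separator belongs to the separator. -/
theorem mem_sep_of_tracked {t : A} (h : Tracked 𝔸 (n := 0) (fun _ => t)) : t ∈ 𝔸.sep := by
  obtain ⟨c, hc, h⟩ := h.out
  exact 𝔸.sep_upward hc (h PUnit.unit)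

theorem top_mem_sep : (⊤ : A) ∈ 𝔸.sep := 𝔸.sep_upward 𝔸.sep_K le_top

instance : Fact ((⊤ : A) ∈ 𝔸.sep) := ⟨top_mem_sep⟩

/-! ### Terms for the connectives -/

variable (𝔸)

/-- Pairing. -/
def pair (a b : A) : A := 𝔸.lam fun z => 𝔸.app (𝔸.app z a) b

/-- First projection. -/
def fst (t : A) : A := 𝔸.app t (𝔸.lam fun x => 𝔸.lam fun _ => x)

/-- Second projection. -/
def snd (t : A) : A := 𝔸.app t (𝔸.lam fun _ => 𝔸.lam fun y => y)

/-- Left injection into a sum. -/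
def inl (t : A) : A := 𝔸.lam fun f => 𝔸.lam fun _ => 𝔸.app f t

/-- Right injection into a sum. -/
def inr (t : A) : A := 𝔸.lam fun _ => 𝔸.lam fun g => 𝔸.app g t

/-- Introduction of the existential quantifier. -/
def exIntro (t : A) : A := 𝔸.lam fun f => 𝔸.app f t

/-- The fixed point `w w` of `f`, with `w = λ x. f (x x)`. -/
def fix (f : A) : A :=
  𝔸.app (𝔸.lam fun x => 𝔸.app f (𝔸.app x x)) (𝔸.lam fun x => 𝔸.app f (𝔸.app x x))

variable {𝔸}

section

variable {n : ℕ} (f g : Env A n → A) [Tracked 𝔸 f] [Tracked 𝔸 g]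

instance : Tracked 𝔸 (fun v => 𝔸.pair (f v) (g v)) := by
  have := Tracked.weaken (𝔸 := 𝔸) f
  have := Tracked.weaken (𝔸 := 𝔸) g
  unfold pair
  infer_instance

instance : Tracked 𝔸 (fun v => 𝔸.fst (f v)) := by
  unfold fst
  infer_instance

instance : Tracked 𝔸 (fun v => 𝔸.snd (f v)) := by
  unfold snd
  infer_instance

instance : Tracked 𝔸 (fun v => 𝔸.inl (f v)) := by
  have := Tracked.weaken (𝔸 := 𝔸) f
  have := Tracked.weaken (𝔸 := 𝔸) (n := n + 1) fun v => f v.1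
  unfold inl
  infer_instance

instance : Tracked 𝔸 (fun v => 𝔸.inr (f v)) := by
  have := Tracked.weaken (𝔸 := 𝔸) f
  have := Tracked.weaken (𝔸 := 𝔸) (n := n + 1) fun v => f v.1
  unfold inr
  infer_instance

instance : Tracked 𝔸 (fun v => 𝔸.exIntro (f v)) := by
  have := Tracked.weaken (𝔸 := 𝔸) f
  unfold exIntro
  infer_instance

instance : Tracked 𝔸 (fun v => 𝔸.fix (f v)) := by
  have := Tracked.weaken (𝔸 := 𝔸) f
  unfold fix
  infer_instance

end

theorem pair_le {t u a b : A} (ht : t ≤ a) (hu : u ≤ b) : 𝔸.pair t u ≤ 𝔸.times a b :=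
  le_iInf fun _ => lam_le fun _ hz => app_le (app_le hz ht) hu

theorem fst_le {t a b : A} (ht : t ≤ 𝔸.times a b) : 𝔸.fst t ≤ a :=
  app_le (ht.trans (iInf_le _ a)) (lam_le fun _ hx => lam_le fun _ _ => hx)

theorem snd_le {t a b : A} (ht : t ≤ 𝔸.times a b) : 𝔸.snd t ≤ b :=
  app_le (ht.trans (iInf_le _ b)) (lam_le fun _ _ => lam_le fun _ hy => hy)

theorem inl_le {t a b : A} (ht : t ≤ a) : 𝔸.inl t ≤ 𝔸.plus a b :=
  le_iInf fun _ => lam_le fun _ hf => lam_le fun _ _ => app_le hf ht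

theorem inr_le {t a b : A} (ht : t ≤ b) : 𝔸.inr t ≤ 𝔸.plus a b :=
  le_iInf fun _ => lam_le fun _ _ => lam_le fun _ hg => app_le hg ht

/-- Case distinction. -/
theorem case_le {t f g a b c : A} (ht : t ≤ 𝔸.plus a b) (hf : f ≤ 𝔸.imp a c)
    (hg : g ≤ 𝔸.imp b c) : 𝔸.app (𝔸.app t f) g ≤ c :=
  app_le (app_le (ht.trans (iInf_le _ c)) hf) hg

theorem exIntro_le {I : Type v} {a : I → A} {t : A} (i : I) (ht : t ≤ a i) :
    𝔸.exIntro t ≤ 𝔸.exist a :=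
  le_iInf fun _ => lam_le fun _ hf => app_le (hf.trans (iInf_le _ i)) ht

/-- Elimination of the existential quantifier. -/
theorem exElim_le {I : Type v} {a : I → A} {t f c : A} (ht : t ≤ 𝔸.exist a)
    (hf : ∀ i, f ≤ 𝔸.imp (a i) c) : 𝔸.app t f ≤ c :=
  app_le (ht.trans (iInf_le _ c)) (le_iInf hf)

theorem fix_le (f : A) : 𝔸.fix f ≤ 𝔸.app f (𝔸.fix f) :=
  beta (fun x => 𝔸.app f (𝔸.app x x)) _

/-- Recursion along the domain relation: the fixed point of `f` lies below every value of `φ` if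
`f` passes from the elements of the domain of `x` to `x`. -/
theorem fix_le_of_inDom {f : A} {φ : Name A → A}
    (h : ∀ x (r : A), (∀ t, Name.InDom t x → r ≤ φ t) → 𝔸.app f r ≤ φ x) (x : Name A) :
    𝔸.fix f ≤ φ x :=
  Name.inDom_wf.induction (C := fun x => 𝔸.fix f ≤ φ x) x fun x ih =>
    (fix_le f).trans (h x _ ih)

end ImplicativeAlgebra

/-! ### Equality and membership -/

namespace ImplicativeAlgebra

variable {A : Type u} [CompleteLattice A] (𝔸 : ImplicativeAlgebra A)

/-- Reflexivity of equality. -/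
def reflTm : A := 𝔸.fix (𝔸.lam fun r =>
  𝔸.pair (𝔸.lam fun a => 𝔸.exIntro (𝔸.pair a r)) (𝔸.lam fun a => 𝔸.exIntro (𝔸.pair a r)))

/-- Symmetry of equality, on a realizer. -/
def symm (t : A) : A := 𝔸.pair (𝔸.snd t) (𝔸.fst t)

/-- Transitivity of equality. -/
def transTm : A := 𝔸.fix (𝔸.lam fun r => 𝔸.lam fun h => 𝔸.lam fun k => 𝔸.pair
  (𝔸.lam fun a => 𝔸.app (𝔸.app (𝔸.fst h) a) (𝔸.lam fun m =>
    𝔸.app (𝔸.app (𝔸.fst k) (𝔸.fst m)) (𝔸.lam fun l =>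
      𝔸.exIntro (𝔸.pair (𝔸.fst l)
        (𝔸.symm (𝔸.app (𝔸.app r (𝔸.symm (𝔸.snd m))) (𝔸.symm (𝔸.snd l))))))))
  (𝔸.lam fun a => 𝔸.app (𝔸.app (𝔸.snd k) a) (𝔸.lam fun m =>
    𝔸.app (𝔸.app (𝔸.snd h) (𝔸.fst m)) (𝔸.lam fun l =>
      𝔸.exIntro (𝔸.pair (𝔸.fst l) (𝔸.app (𝔸.app r (𝔸.snd l)) (𝔸.snd m)))))))

/-- Transitivity of equality, on realizers. -/
def trans (t u : A) : A := 𝔸.app (𝔸.app 𝔸.transTm t) u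

/-- Congruence of membership in both arguments: from `x = x'`, `y = y'` and `x ∈ y` to
`x' ∈ y'`. -/
def memCongr (t u m : A) : A :=
  𝔸.app m (𝔸.lam fun p => 𝔸.app (𝔸.app (𝔸.fst u) (𝔸.fst p)) (𝔸.lam fun q =>
    𝔸.exIntro (𝔸.pair (𝔸.fst q) (𝔸.trans (𝔸.snd q) (𝔸.trans (𝔸.snd p) t)))))

variable {𝔸}

instance {n : ℕ} (f : Env A n → A) [Tracked 𝔸 f] : Tracked 𝔸 (fun v => 𝔸.symm (f v)) := by
  unfold symm
  infer_instance

instance : Fact (𝔸.reflTm ∈ 𝔸.sep) := ⟨mem_sep_of_tracked (by unfold reflTm; infer_instance)⟩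

instance : Fact (𝔸.transTm ∈ 𝔸.sep) := ⟨mem_sep_of_tracked (by unfold transTm; infer_instance)⟩

instance {n : ℕ} (f g : Env A n → A) [Tracked 𝔸 f] [Tracked 𝔸 g] :
    Tracked 𝔸 (fun v => 𝔸.trans (f v) (g v)) := by
  unfold trans
  infer_instance

instance {n : ℕ} (f g h : Env A n → A) [Tracked 𝔸 f] [Tracked 𝔸 g] [Tracked 𝔸 h] :
    Tracked 𝔸 (fun v => 𝔸.memCongr (f v) (g v) (h v)) := by
  have := Tracked.weaken (𝔸 := 𝔸) f
  have := Tracked.weaken (𝔸 := 𝔸) (n := n + 1) fun v => f v.1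
  have := Tracked.weaken (𝔸 := 𝔸) g
  unfold memCongr
  infer_instance

theorem reflTm_le (x : Name A) : 𝔸.reflTm ≤ 𝔸.eqW x x := by
  refine fix_le_of_inDom (φ := fun x => 𝔸.eqW x x) (fun x r hr => (beta _ _).trans ?_) x
  rw [eqW]
  have h : 𝔸.lam (fun a => 𝔸.exIntro (𝔸.pair a r)) ≤
      ⨅ p : x.graph, 𝔸.imp p.1.2 (𝔸.memW p.1.1 x) := by
    refine le_iInf fun p => lam_le fun a ha => ?_
    rw [memW]
    exact exIntro_le p (pair_le ha (hr p.1.1 ⟨p.1.2, p.2⟩))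
  exact pair_le h h

theorem symm_le {t : A} {x y : Name A} (ht : t ≤ 𝔸.eqW x y) : 𝔸.symm t ≤ 𝔸.eqW y x := by
  rw [eqW] at ht ⊢
  exact pair_le (snd_le ht) (fst_le ht)

theorem app_fst_le {t u a : A} {x y s : Name A} (ht : t ≤ 𝔸.eqW x y) (hs : (s, a) ∈ x.graph)
    (hu : u ≤ a) : 𝔸.app (𝔸.fst t) u ≤ 𝔸.memW s y := by
  rw [eqW] at ht
  exact app_le ((fst_le ht).trans (iInf_le _ (⟨(s, a), hs⟩ : x.graph))) hu

theorem app_snd_le {t u a : A} {x y s : Name A} (ht : t ≤ 𝔸.eqW x y) (hs : (s, a) ∈ y.graph)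
    (hu : u ≤ a) : 𝔸.app (𝔸.snd t) u ≤ 𝔸.memW s x := by
  rw [eqW] at ht
  exact app_le ((snd_le ht).trans (iInf_le _ (⟨(s, a), hs⟩ : y.graph))) hu

/-- Elimination of membership. -/
theorem memElim_le {t c : A} {f : A → A} {x y : Name A} (ht : t ≤ 𝔸.memW x y)
    (hf : ∀ s a, (s, a) ∈ y.graph → ∀ q, q ≤ 𝔸.times a (𝔸.eqW s x) → f q ≤ c) :
    𝔸.app t (𝔸.lam f) ≤ c := by
  rw [memW] at ht
  exact exElim_le ht fun p => lam_le fun q hq => hf p.1.1 p.1.2 p.2 q hq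

theorem memIntro_le {t u a : A} {x y s : Name A} (hs : (s, a) ∈ y.graph) (ht : t ≤ a)
    (hu : u ≤ 𝔸.eqW s x) : 𝔸.exIntro (𝔸.pair t u) ≤ 𝔸.memW x y := by
  rw [memW]
  exact exIntro_le (⟨(s, a), hs⟩ : y.graph) (pair_le ht hu)

theorem pair_le_eqW {t u : A} {x y : Name A}
    (ht : ∀ s a, (s, a) ∈ x.graph → t ≤ 𝔸.imp a (𝔸.memW s y))
    (hu : ∀ s a, (s, a) ∈ y.graph → u ≤ 𝔸.imp a (𝔸.memW s x)) :
    𝔸.pair t u ≤ 𝔸.eqW x y := by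
  rw [eqW]
  exact pair_le (le_iInf fun p => ht _ _ p.2) (le_iInf fun p => hu _ _ p.2)

/-- The recursion is on `x` alone: the one half that would need it at the third name is turned
around by symmetry. -/
theorem transTm_le (x y z : Name A) :
    𝔸.transTm ≤ 𝔸.imp (𝔸.eqW x y) (𝔸.imp (𝔸.eqW y z) (𝔸.eqW x z)) := by
  have key : 𝔸.transTm ≤ ⨅ (y : Name A) (z : Name A),
      𝔸.imp (𝔸.eqW x y) (𝔸.imp (𝔸.eqW y z) (𝔸.eqW x z)) := by
    refine fix_le_of_inDom (φ := fun x => ⨅ (y : Name A) (z : Name A),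
      𝔸.imp (𝔸.eqW x y) (𝔸.imp (𝔸.eqW y z) (𝔸.eqW x z)))
      (fun x r hr => (beta _ _).trans (le_iInf₂ fun y z => ?_)) x
    have hr' : ∀ s a, (s, a) ∈ x.graph → ∀ {t u y' z'}, t ≤ 𝔸.eqW s y' → u ≤ 𝔸.eqW y' z' →
        𝔸.app (𝔸.app r t) u ≤ 𝔸.eqW s z' := fun s a hs t u y' z' ht hu =>
      app_le (app_le ((hr s ⟨a, hs⟩).trans ((iInf_le _ y').trans (iInf_le _ z'))) ht) hu
    refine lam_le fun h hh => lam_le fun k hk => pair_le_eqW ?_ ?_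
    · refine fun p a hp => lam_le fun b hb => memElim_le (app_fst_le hh hp hb) ?_
      refine fun q c hq m hm => memElim_le (app_fst_le hk hq (fst_le hm)) ?_
      exact fun s d hs l hl => memIntro_le hs (fst_le hl)
        (symm_le (hr' p a hp (symm_le (snd_le hm)) (symm_le (snd_le hl))))
    · refine fun p a hp => lam_le fun b hb => memElim_le (app_snd_le hk hp hb) ?_
      refine fun q c hq m hm => memElim_le (app_snd_le hh hq (fst_le hm)) ?_
      exact fun s d hs l hl => memIntro_le hs (fst_le hl) (hr' s d hs (snd_le hl) (snd_le hm))
  exact key.trans ((iInf_le _ y).trans (iInf_le _ z))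

theorem trans_le {t u : A} {x y z : Name A} (ht : t ≤ 𝔸.eqW x y) (hu : u ≤ 𝔸.eqW y z) :
    𝔸.trans t u ≤ 𝔸.eqW x z :=
  app_le (app_le (transTm_le x y z) ht) hu

theorem memCongr_le {t u m : A} {x x' y y' : Name A} (ht : t ≤ 𝔸.eqW x x')
    (hu : u ≤ 𝔸.eqW y y') (hm : m ≤ 𝔸.memW x y) : 𝔸.memCongr t u m ≤ 𝔸.memW x' y' :=
  memElim_le hm fun _ _ hs _ hp => memElim_le (app_fst_le hu hs (fst_le hp)) fun _ _ hs' _ hq =>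
    memIntro_le hs' (fst_le hq) (trans_le (snd_le hq) (trans_le (snd_le hp) ht))

/-! ### Substitution in formulas -/

variable {κ : Cardinal.{u}}

/-- Equal names may be substituted for a variable, with a realizer depending only on the
formula. -/
theorem exists_subst {n : ℕ} (φ : Fml n) (i : Fin n) : ∃ c ∈ 𝔸.sep, ∀ (α : Fin n → W A κ)
    (β : W A κ), c ≤ 𝔸.imp (𝔸.eqW (α i).1 β.1)
      (𝔸.imp (𝔸.interp κ φ α) (𝔸.interp κ φ (Function.update α i β))) := by
  -- a realizer of the equality of the old and the new value of the variable `j`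
  have hvar : ∀ {n : ℕ} (i j : Fin n), ∃ c ∈ 𝔸.sep, ∀ (α : Fin n → W A κ) (β : W A κ),
      ∀ e ≤ 𝔸.eqW (α i).1 β.1, 𝔸.app c e ≤ 𝔸.eqW (α j).1 (Function.update α i β j).1 := by
    intro n i j
    by_cases h : j = i
    · subst h
      refine ⟨𝔸.lam fun e => e, mem_sep_of_tracked inferInstance, fun α β e he => ?_⟩
      rw [Function.update_self]
      exact (beta _ _).trans he
    · refine ⟨𝔸.lam fun _ => 𝔸.reflTm, mem_sep_of_tracked inferInstance, fun α β e he => ?_⟩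
      rw [Function.update_of_ne h]
      exact (beta _ _).trans (reflTm_le _)
  induction φ with
  | bot => exact ⟨𝔸.lam fun _ => 𝔸.lam fun m => m, mem_sep_of_tracked inferInstance,
      fun α β => lam_le fun e _ => lam_le fun m hm => hm⟩
  | mem j k =>
    obtain ⟨c, hc, hj⟩ := hvar i j
    obtain ⟨d, hd, hk⟩ := hvar i k
    have := Fact.mk hc
    have := Fact.mk hd
    exact ⟨𝔸.lam fun e => 𝔸.lam fun m => 𝔸.memCongr (𝔸.app c e) (𝔸.app d e) m,
      mem_sep_of_tracked inferInstance, fun α β => lam_le fun e he => lam_le fun m hm =>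
        memCongr_le (hj α β e he) (hk α β e he) hm⟩
  | eq j k =>
    obtain ⟨c, hc, hj⟩ := hvar i j
    obtain ⟨d, hd, hk⟩ := hvar i k
    have := Fact.mk hc
    have := Fact.mk hd
    exact ⟨𝔸.lam fun e => 𝔸.lam fun m => 𝔸.trans (𝔸.symm (𝔸.app c e)) (𝔸.trans m (𝔸.app d e)),
      mem_sep_of_tracked inferInstance, fun α β => lam_le fun e he => lam_le fun m hm =>
        trans_le (symm_le (hj α β e he)) (trans_le hm (hk α β e he))⟩
  | and φ ψ ihφ ihψ =>
    obtain ⟨c, hc, h⟩ := ihφ i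
    obtain ⟨d, hd, h'⟩ := ihψ i
    have := Fact.mk hc
    have := Fact.mk hd
    exact ⟨𝔸.lam fun e => 𝔸.lam fun m =>
        𝔸.pair (𝔸.app (𝔸.app c e) (𝔸.fst m)) (𝔸.app (𝔸.app d e) (𝔸.snd m)),
      mem_sep_of_tracked inferInstance, fun α β => lam_le fun e he => lam_le fun m hm =>
        pair_le (app_le (app_le (h α β) he) (fst_le hm)) (app_le (app_le (h' α β) he) (snd_le hm))⟩
  | or φ ψ ihφ ihψ =>
    obtain ⟨c, hc, h⟩ := ihφ i
    obtain ⟨d, hd, h'⟩ := ihψ i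
    have := Fact.mk hc
    have := Fact.mk hd
    exact ⟨𝔸.lam fun e => 𝔸.lam fun m =>
        𝔸.app (𝔸.app m (𝔸.lam fun a => 𝔸.inl (𝔸.app (𝔸.app c e) a)))
          (𝔸.lam fun b => 𝔸.inr (𝔸.app (𝔸.app d e) b)),
      mem_sep_of_tracked inferInstance, fun α β => lam_le fun e he => lam_le fun m hm =>
        case_le hm (lam_le fun a ha => inl_le (app_le (app_le (h α β) he) ha))
          (lam_le fun a ha => inr_le (app_le (app_le (h' α β) he) ha))⟩
  | imp φ ψ ihφ ihψ =>
    obtain ⟨c, hc, h⟩ := ihφ i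
    obtain ⟨d, hd, h'⟩ := ihψ i
    have := Fact.mk hc
    have := Fact.mk hd
    refine ⟨𝔸.lam fun e => 𝔸.lam fun m => 𝔸.lam fun a =>
        𝔸.app (𝔸.app d e) (𝔸.app m (𝔸.app (𝔸.app c (𝔸.symm e)) a)),
      mem_sep_of_tracked inferInstance, fun α β => lam_le fun e he => lam_le fun m hm =>
        lam_le fun a ha => app_le (app_le (h' α β) he) (app_le hm ?_)⟩
    have h₁ := h (Function.update α i β) (α i)
    rw [Function.update_self, Function.update_idem, Function.update_eq_self] at h₁
    exact app_le (app_le h₁ (symm_le he)) ha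
  | ex φ ih =>
    obtain ⟨c, hc, h⟩ := ih i.castSucc
    have := Fact.mk hc
    refine ⟨𝔸.lam fun e => 𝔸.lam fun m => 𝔸.app m (𝔸.lam fun a =>
        𝔸.exIntro (𝔸.app (𝔸.app c e) a)),
      mem_sep_of_tracked inferInstance, fun α β => lam_le fun e he => lam_le fun m hm =>
        exElim_le hm fun γ => lam_le fun a ha => exIntro_le γ ?_⟩
    rw [Fin.snoc_update]
    refine app_le (app_le (h _ β) ?_) ha
    rwa [Fin.snoc_castSucc (α := fun _ => W A κ)]
  | all φ ih =>
    obtain ⟨c, hc, h⟩ := ih i.castSucc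
    have := Fact.mk hc
    refine ⟨𝔸.lam fun e => 𝔸.lam fun m => 𝔸.app (𝔸.app c e) m,
      mem_sep_of_tracked inferInstance, fun α β => lam_le fun e he => lam_le fun m hm =>
        le_iInf fun γ => ?_⟩
    rw [Fin.snoc_update]
    refine app_le (app_le (h _ β) ?_) (hm.trans (iInf_le _ γ))
    rwa [Fin.snoc_castSucc (α := fun _ => W A κ)]

/-- Substitution for the last variable. -/
theorem exists_subst_last {n : ℕ} (φ : Fml (n + 1)) : ∃ c ∈ 𝔸.sep, ∀ (α : Fin n → W A κ)
    (β γ : W A κ), c ≤ 𝔸.imp (𝔸.eqW β.1 γ.1)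
      (𝔸.imp (𝔸.interp κ φ (Fin.snoc (α := fun _ => W A κ) α β))
        (𝔸.interp κ φ (Fin.snoc (α := fun _ => W A κ) α γ))) := by
  obtain ⟨c, hc, h⟩ := exists_subst (𝔸 := 𝔸) (κ := κ) φ (Fin.last n)
  refine ⟨c, hc, fun α β γ => ?_⟩
  have h' := h (Fin.snoc (α := fun _ => W A κ) α β) γ
  rwa [Fin.snoc_last (α := fun _ => W A κ), Fin.update_snoc_last] at h'

/-- Substitution of variables amounts to precomposition of the valuation. -/
theorem interp_rename {n m : ℕ} (φ : Fml n) (f : Fin n → Fin m) (α : Fin m → W A κ) :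
    𝔸.interp κ (φ.rename f) α = 𝔸.interp κ φ (fun i => α (f i)) := by
  have hs : ∀ {n m : ℕ} (f : Fin n → Fin m) (α : Fin m → W A κ) (β : W A κ),
      (fun i => Fin.snoc (α := fun _ => W A κ) α β
        (Fin.snoc (α := fun _ => Fin (m + 1)) (fun i => (f i).castSucc) (Fin.last m) i)) =
      Fin.snoc (α := fun _ => W A κ) (fun i => α (f i)) β := by
    intro n m f α β
    funext i
    refine Fin.lastCases ?_ (fun i => ?_) i <;> simp
  induction φ generalizing m with
  | bot => rfl
  | mem i j => rfl
  | eq i j => rfl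
  | and φ ψ ihφ ihψ => simp only [Fml.rename, interp, ihφ, ihψ]
  | or φ ψ ihφ ihψ => simp only [Fml.rename, interp, ihφ, ihψ]
  | imp φ ψ ihφ ihψ => simp only [Fml.rename, interp, ihφ, ihψ]
  | ex φ ih => simp only [Fml.rename, interp, ih, hs]
  | all φ ih => simp only [Fml.rename, interp, ih, hs]

theorem interp_close_mem_sep {n : ℕ} (φ : Fml n)
    (h : ∃ c ∈ 𝔸.sep, ∀ α, c ≤ 𝔸.interp κ φ α) : 𝔸.interp κ φ.close ![] ∈ 𝔸.sep := by
  induction n with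
  | zero =>
    obtain ⟨c, hc, h⟩ := h
    exact 𝔸.sep_upward hc (h _)
  | succ n ih =>
    obtain ⟨c, hc, h⟩ := h
    exact ih _ ⟨c, hc, fun α => le_iInf fun β => h _⟩

end ImplicativeAlgebra

/-! ### Names and the cumulative hierarchies -/

theorem mk_arrow_lt {κ : Cardinal.{u}} (hκ : κ.IsInaccessible) {ι B : Type u} (hι : #ι < κ)
    (hB : #B < κ) : #(ι → B) < κ := by
  have h : #(ι → B) ≤ 2 ^ (#B * #ι) := by
    rw [← power_def, power_mul]
    exact power_le_power_right (cantor _).le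
  exact h.trans_lt (hκ.isStrongPrelimit (mul_lt_of_lt hκ.aleph0_lt.le hB hι))

namespace Name

variable {A : Type u}

theorem exists_graph_eq_range {ι : Type u} (t : ι → Name A) (a : ι → A) :
    ∃ x : Name A, x.graph = Set.range fun i => (t i, a i) := by
  refine ⟨Quotient.mk (PreName.setoid A) (.mk ι (fun i => Quotient.out (t i)) a), ?_⟩
  ext p
  exact exists_congr fun i => eq_comm.trans
    (Eq.congr (Prod.ext (Quotient.out_eq (t i)) rfl) rfl)

theorem exists_range_eq_graph (x : Name A) :
    ∃ (ι : Type u) (t : ι → Name A) (a : ι → A), x.graph = Set.range fun i => (t i, a i) := by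
  induction x using Quotient.inductionOn with
  | h x =>
    obtain ⟨ι, t, a⟩ := x
    refine ⟨ι, fun i => Quotient.mk (PreName.setoid A) (t i), a, ?_⟩
    ext p
    exact exists_congr fun i => eq_comm

instance small_graph (x : Name A) : Small.{u} x.graph := by
  obtain ⟨ι, t, a, h⟩ := x.exists_range_eq_graph
  rw [h]
  infer_instance

theorem exists_graph_eq (S : Set (Name A × A)) [Small.{u} S] : ∃ x : Name A, x.graph = S := by
  obtain ⟨x, hx⟩ := exists_graph_eq_range
    (fun i : Shrink.{u} S => ((equivShrink S).symm i).1.1) fun i => ((equivShrink S).symm i).1.2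
  refine ⟨x, hx.trans ?_⟩
  ext p
  constructor
  · rintro ⟨i, rfl⟩
    exact ((equivShrink S).symm i).2
  · exact fun hp => ⟨equivShrink S ⟨p, hp⟩, by simp⟩

theorem graph_injective : Function.Injective (graph : Name A → Set (Name A × A)) := by
  intro x y
  induction x using Quotient.inductionOn with
  | h x =>
  induction y using Quotient.inductionOn with
  | h y =>
    obtain ⟨ι, t, a⟩ := x
    obtain ⟨ι', t', a'⟩ := y
    intro h
    refine Quotient.sound ⟨fun i => ?_, fun j => ?_⟩
    · have hi : (Quotient.mk (PreName.setoid A) (t i), a i) ∈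
          graph (Quotient.mk (PreName.setoid A) (.mk ι t a)) := ⟨i, rfl⟩
      rw [h] at hi
      obtain ⟨j, hj⟩ := hi
      exact ⟨j, Quotient.exact (congrArg Prod.fst hj), congrArg Prod.snd hj⟩
    · have hj : (Quotient.mk (PreName.setoid A) (t' j), a' j) ∈
          graph (Quotient.mk (PreName.setoid A) (.mk ι' t' a')) := ⟨j, rfl⟩
      rw [← h] at hj
      obtain ⟨i, hi⟩ := hj
      exact ⟨i, Quotient.exact (congrArg Prod.fst hi.symm), (congrArg Prod.snd hi).symm⟩

theorem part_mono : Monotone (part : Set (Name A) → Set (Name A)) :=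
  fun _ _ h _ hf => ⟨fun t a ht => h (hf.1 t a ht), hf.2⟩

theorem pow_mono : Monotone (pow : Set (Name A) → Set (Name A)) :=
  fun _ _ h _ hf t a ht => h (hf t a ht)

theorem mem_hierarchy_iff {F : Set (Name A) → Set (Name A)} (hF : Monotone F) {x : Name A}
    {β : Ordinal.{u}} : x ∈ hierarchy F β ↔ ∃ γ < β, x ∈ F (hierarchy F γ) := by
  induction β using WellFoundedLT.induction generalizing x with
  | ind β ih =>
  rcases Ordinal.zero_or_succ_or_isSuccLimit β with rfl | ⟨δ, hδ⟩ | hβ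
  · simp [hierarchy]
  · obtain rfl : δ + 1 = β := hδ
    have h : hierarchy F (δ + 1) = F (hierarchy F δ) := by
      simp only [hierarchy, Ordinal.limitRecOn_add_one]
    have hδ : δ < δ + 1 := Order.lt_add_one_iff.2 le_rfl
    rw [h]
    refine ⟨fun hx => ⟨δ, hδ, hx⟩, ?_⟩
    rintro ⟨γ, hγ, hx⟩
    refine hF (fun y hy => ?_) hx
    obtain ⟨ε, hε, hy⟩ := (ih γ hγ).1 hy
    exact (ih δ hδ).2 ⟨ε, hε.trans_le (Order.lt_add_one_iff.1 hγ), hy⟩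
  · have h : hierarchy F β = ⋃ (γ : Ordinal.{u}) (_ : γ < β), hierarchy F γ := by
      simp only [hierarchy, Ordinal.limitRecOn_limit _ _ _ _ hβ]
    simp only [h, Set.mem_iUnion]
    constructor
    · rintro ⟨γ, hγ, hx⟩
      obtain ⟨ε, hε, hx⟩ := (ih γ hγ).1 hx
      exact ⟨ε, hε.trans hγ, hx⟩
    · rintro ⟨γ, hγ, hx⟩
      have hγ' := hβ.succ_lt hγ
      exact ⟨_, hγ', (ih _ hγ').2 ⟨γ, Order.lt_succ γ, hx⟩⟩

theorem hierarchy_mono {F : Set (Name A) → Set (Name A)} (hF : Monotone F) :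
    Monotone (hierarchy F) := by
  intro β γ h x hx
  obtain ⟨δ, hδ, hx⟩ := (mem_hierarchy_iff hF).1 hx
  exact (mem_hierarchy_iff hF).2 ⟨δ, hδ.trans_le h, hx⟩

theorem mem_hierarchy_part_of_graph {β : Ordinal.{u}} {x t : Name A} {a : A}
    (hx : x ∈ hierarchy part β) (h : (t, a) ∈ x.graph) : t ∈ hierarchy part β := by
  obtain ⟨γ, hγ, hx⟩ := (mem_hierarchy_iff part_mono).1 hx
  exact hierarchy_mono part_mono hγ.le (hx.1 t a h)

/-- Below a strongly inaccessible cardinal `κ > |A|`, every stage of the hierarchy of partial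
functions has fewer than `κ` elements. -/
theorem exists_cover_hierarchy_part {κ : Cardinal.{u}} (hκ : κ.IsInaccessible) (hA : #A < κ)
    {β : Ordinal.{u}} (hβ : β < κ.ord) :
    ∃ (ι : Type u) (t : ι → Name A), #ι < κ ∧ hierarchy part β ⊆ Set.range t := by
  induction β using WellFoundedLT.induction with
  | ind β ih =>
  choose ι t hι ht using fun γ : Set.Iio β => ih γ γ.2 (γ.2.trans hβ)
  -- a partial function on the stage `γ` is coded by a map from `ι γ` to `Option A`
  have hcode : ∀ (γ : Set.Iio β) (g : ι γ → Option A),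
      ∃ x : Name A, x.graph = {p | ∃ i, t γ i = p.1 ∧ g i = some p.2} := by
    intro γ g
    obtain ⟨x, hx⟩ := exists_graph_eq_range
      (fun j : {p : ι γ × A // g p.1 = some p.2} => t γ j.1.1) fun j => j.1.2
    refine ⟨x, hx.trans ?_⟩
    ext ⟨s, a⟩
    constructor
    · rintro ⟨⟨⟨i, b⟩, hb⟩, h⟩
      obtain ⟨rfl, rfl⟩ := Prod.mk.inj h
      exact ⟨i, rfl, hb⟩
    · rintro ⟨i, rfl, hi⟩
      exact ⟨⟨(i, a), hi⟩, rfl⟩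
  choose F hF using hcode
  refine ⟨Σ d : β.ToType, (ι d.toOrd → Option A), fun p => F _ p.2, ?_, ?_⟩
  · rw [mk_sigma]
    refine sum_lt_of_isRegular hκ.isRegular ?_ fun d => ?_
    · rw [mk_toType]
      exact lt_ord.1 hβ
    · have hO : #(Option A) < κ := by
        rw [mk_option]
        exact add_lt_of_lt hκ.aleph0_lt.le hA (hκ.nat_lt 1 |>.trans_eq' (by simp))
      exact mk_arrow_lt hκ (hι d.toOrd) hO
  · intro x hx
    obtain ⟨γ, hγ, hx⟩ := (mem_hierarchy_iff part_mono).1 hx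
    classical
    obtain ⟨d, rfl⟩ : ∃ d : β.ToType, d.toOrd.1 = γ :=
      ⟨Ordinal.ToType.mk ⟨γ, hγ⟩, congrArg Subtype.val (OrderIso.symm_apply_apply _ _)⟩
    let g : ι d.toOrd → Option A := fun i =>
      if h : ∃ a, (t d.toOrd i, a) ∈ x.graph then some h.choose else none
    refine ⟨⟨d, g⟩, graph_injective ?_⟩
    rw [hF]
    ext ⟨s, a⟩
    constructor
    · rintro ⟨i, rfl, hi⟩
      by_cases h : ∃ a, (t d.toOrd i, a) ∈ x.graph
      · simp only [g, dif_pos h, Option.some.injEq] at hi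
        rw [← hi]
        exact h.choose_spec
      · simp [g, dif_neg h] at hi
    · intro h
      obtain ⟨i, rfl⟩ := ht d.toOrd (hx.1 _ _ h)
      refine ⟨i, rfl, ?_⟩
      have h' : ∃ a, (t d.toOrd i, a) ∈ x.graph := ⟨a, h⟩
      simp only [g, dif_pos h', Option.some.injEq]
      exact hx.2 _ _ _ h'.choose_spec h

end Name

namespace W

variable {A : Type u} {κ : Cardinal.{u}}

theorem mem_of_graph (x : W A κ) {t : Name A} {a : A} (h : (t, a) ∈ x.1.graph) :
    t ∈ Name.hierarchy Name.part κ.ord :=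
  Name.mem_hierarchy_part_of_graph x.2 h

theorem eq_of_graph (x : W A κ) {t : Name A} {a b : A} (h : (t, a) ∈ x.1.graph)
    (h' : (t, b) ∈ x.1.graph) : a = b := by
  obtain ⟨γ, -, hx⟩ := (Name.mem_hierarchy_iff Name.part_mono).1 x.2
  exact hx.2 t a b h h'

/-- A partial function with fewer than `κ` arguments, all of them in `W`, is an element of `W`. -/
theorem exists_graph (hκ : κ.IsRegular) {ι : Type u} (hι : #ι < κ) (t : ι → W A κ) (a : ι → A)
    (h : ∀ i j, t i = t j → a i = a j) :
    ∃ x : W A κ, x.1.graph = Set.range fun i => ((t i).1, a i) := by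
  obtain ⟨x, hx⟩ := Name.exists_graph_eq_range (fun i => (t i).1) a
  choose γ hγ ht using fun i => (Name.mem_hierarchy_iff Name.part_mono).1 (t i).2
  refine ⟨⟨x, (Name.mem_hierarchy_iff Name.part_mono).2 ⟨⨆ i, γ i + 1, ?_, ?_, ?_⟩⟩, hx⟩
  · exact Ordinal.iSup_add_one_lt_of_lt_cof (by rwa [hκ.cof_ord]) hγ
  · intro s b hs
    rw [hx] at hs
    obtain ⟨i, hi⟩ := hs
    obtain ⟨rfl, rfl⟩ := Prod.mk.inj hi
    exact (Name.mem_hierarchy_iff Name.part_mono).2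
      ⟨γ i, Ordinal.lt_iSup_add_one _ i, ht i⟩
  · intro s b c hb hc
    rw [hx] at hb hc
    obtain ⟨i, hi⟩ := hb
    obtain ⟨j, hj⟩ := hc
    have e := h i j (Subtype.ext ((congrArg Prod.fst hi).trans (congrArg Prod.fst hj).symm))
    exact ((congrArg Prod.snd hi).symm.trans e).trans (congrArg Prod.snd hj)

/-- The domain of an element of `W` has fewer than `κ` elements. -/
theorem exists_range_eq (hκ : κ.IsInaccessible) (hA : #A < κ) (x : W A κ) :
    ∃ (ι : Type u) (t : ι → W A κ) (a : ι → A), #ι < κ ∧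
      x.1.graph = Set.range fun i => ((t i).1, a i) := by
  obtain ⟨γ, hγ, hx⟩ := (Name.mem_hierarchy_iff Name.part_mono).1 x.2
  obtain ⟨ι, t, hι, ht⟩ := Name.exists_cover_hierarchy_part hκ hA hγ
  choose a ha using fun i : {i : ι // ∃ a, (t i, a) ∈ x.1.graph} => i.2
  refine ⟨_, fun i => ⟨t i.1, x.mem_of_graph (ha i)⟩, a, (mk_subtype_le _).trans_lt hι, ?_⟩
  ext ⟨s, b⟩
  constructor
  · intro h
    obtain ⟨i, rfl⟩ := ht (hx.1 _ _ h)
    exact ⟨⟨i, b, h⟩, Prod.ext rfl (x.eq_of_graph (ha _) h)⟩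
  · rintro ⟨i, hi⟩
    obtain ⟨rfl, rfl⟩ := Prod.mk.inj hi
    exact ha i

theorem exists_graph_eq_empty (hκ : κ.IsRegular) : ∃ x : W A κ, x.1.graph = ∅ := by
  obtain ⟨x, hx⟩ := exists_graph (A := A) hκ (ι := PEmpty)
    (by simpa using aleph0_pos.trans_le hκ.aleph0_le) PEmpty.elim PEmpty.elim fun i => i.elim
  exact ⟨x, hx.trans (Set.range_eq_empty _)⟩

end W

/-! ### The axioms of IZF -/

namespace ImplicativeAlgebra

variable {A : Type u} [CompleteLattice A] {𝔸 : ImplicativeAlgebra A} {κ : Cardinal.{u}}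

theorem memElimW_le {t c : A} {f : A → A} {x : Name A} {y : W A κ} (ht : t ≤ 𝔸.memW x y.1)
    (hf : ∀ (s : W A κ) (a : A), (s.1, a) ∈ y.1.graph →
      ∀ q, q ≤ 𝔸.times a (𝔸.eqW s.1 x) → f q ≤ c) :
    𝔸.app t (𝔸.lam f) ≤ c :=
  memElim_le ht fun s a hs q hq => hf ⟨s, y.mem_of_graph hs⟩ a hs q hq

/-- For `s` in the domain of `y`, a realizer of `y(s)` gives one of `s ∈ y`. -/
theorem memIntro_refl_le {t a : A} {y s : Name A} (hs : (s, a) ∈ y.graph) (ht : t ≤ a) :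
    𝔸.exIntro (𝔸.pair t 𝔸.reflTm) ≤ 𝔸.memW s y :=
  memIntro_le hs ht (reflTm_le s)

theorem not_mem_le {x : W A κ} (hx : x.1.graph = ∅) :
    𝔸.lam (fun m => 𝔸.app m ⊤) ≤ ⨅ y : W A κ, 𝔸.imp (𝔸.memW y.1 x.1) ⊥ := by
  refine le_iInf fun y => lam_le fun m hm => ?_
  rw [memW] at hm
  exact exElim_le hm fun p => absurd p.2 (by simp [hx])

theorem interp_emptyAx (hκ : κ.IsRegular) : 𝔸.interp κ Fml.emptyAx ![] ∈ 𝔸.sep := by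
  obtain ⟨x, hx⟩ := W.exists_graph_eq_empty (A := A) hκ
  refine 𝔸.sep_upward (a := 𝔸.exIntro (𝔸.lam fun m => 𝔸.app m ⊤))
    (mem_sep_of_tracked inferInstance) ?_
  exact exIntro_le x (not_mem_le hx)

theorem interp_extAx : 𝔸.interp κ Fml.extAx ![] ∈ 𝔸.sep := by
  refine 𝔸.sep_upward (a := 𝔸.lam fun h => 𝔸.pair
      (𝔸.lam fun a => 𝔸.app (𝔸.fst h) (𝔸.exIntro (𝔸.pair a 𝔸.reflTm)))
      (𝔸.lam fun a => 𝔸.app (𝔸.snd h) (𝔸.exIntro (𝔸.pair a 𝔸.reflTm))))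
    (mem_sep_of_tracked inferInstance) ?_
  refine le_iInf fun x => le_iInf fun y => ?_
  change _ ≤ 𝔸.imp (𝔸.times (⨅ z : W A κ, 𝔸.imp (𝔸.memW z.1 x.1) (𝔸.memW z.1 y.1))
    (⨅ z : W A κ, 𝔸.imp (𝔸.memW z.1 y.1) (𝔸.memW z.1 x.1))) (𝔸.eqW x.1 y.1)
  refine lam_le fun h hh => pair_le_eqW (fun s a hs => lam_le fun b hb => ?_)
    (fun s a hs => lam_le fun b hb => ?_)
  · exact app_le ((fst_le hh).trans (iInf_le _ (⟨s, x.mem_of_graph hs⟩ : W A κ)))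
      (memIntro_refl_le hs hb)
  · exact app_le ((snd_le hh).trans (iInf_le _ (⟨s, y.mem_of_graph hs⟩ : W A κ)))
      (memIntro_refl_le hs hb)

theorem interp_pairAx (hκ : κ.IsInaccessible) : 𝔸.interp κ Fml.pairAx ![] ∈ 𝔸.sep := by
  refine 𝔸.sep_upward (a := 𝔸.exIntro (𝔸.pair (𝔸.exIntro (𝔸.pair ⊤ 𝔸.reflTm))
      (𝔸.exIntro (𝔸.pair ⊤ 𝔸.reflTm)))) (mem_sep_of_tracked inferInstance) ?_
  refine le_iInf fun x => le_iInf fun y => ?_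
  obtain ⟨z, hz⟩ := W.exists_graph hκ.isRegular (ι := ULift Bool)
    (by simpa using hκ.nat_lt 2) (fun b => if b.down then x else y) (fun _ => (⊤ : A))
    fun _ _ _ => rfl
  refine exIntro_le z (pair_le ?_ ?_)
  · exact memIntro_refl_le (s := x.1) (y := z.1) (a := ⊤) (by rw [hz]; exact ⟨⟨true⟩, rfl⟩) le_rfl
  · exact memIntro_refl_le (s := y.1) (y := z.1) (a := ⊤) (by rw [hz]; exact ⟨⟨false⟩, rfl⟩) le_rfl

theorem interp_unionAx (hκ : κ.IsInaccessible) (hA : #A < κ) :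
    𝔸.interp κ Fml.unionAx ![] ∈ 𝔸.sep := by
  refine 𝔸.sep_upward (a := 𝔸.exIntro (𝔸.lam fun m => 𝔸.lam fun k => 𝔸.app m (𝔸.lam fun q =>
      𝔸.app (𝔸.memCongr 𝔸.reflTm (𝔸.symm (𝔸.snd q)) k) (𝔸.lam fun r =>
        𝔸.exIntro (𝔸.pair ⊤ (𝔸.snd r)))))) (mem_sep_of_tracked inferInstance) ?_
  refine le_iInf fun x => ?_
  obtain ⟨ι, t, a, hι, hx⟩ := x.exists_range_eq hκ hA
  choose ι' t' a' hι' ht' using fun i => (t i).exists_range_eq hκ hA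
  obtain ⟨u, hu⟩ := W.exists_graph hκ.isRegular (ι := Σ i, ι' i)
    (by rw [mk_sigma]; exact sum_lt_of_isRegular hκ.isRegular hι hι') (fun p => t' p.1 p.2)
    (fun _ => (⊤ : A)) fun _ _ _ => rfl
  refine exIntro_le u (le_iInf fun y => lam_le fun m hm => le_iInf fun z => lam_le fun k hk => ?_)
  change k ≤ 𝔸.memW z.1 y.1 at hk
  change _ ≤ 𝔸.memW z.1 u.1
  refine memElimW_le (y := x) hm fun s b hs q hq => ?_
  refine memElimW_le (memCongr_le (reflTm_le _) (symm_le (snd_le hq)) hk) fun s' b' hs' r hr => ?_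
  refine memIntro_le (s := s'.1) (a := ⊤) ?_ le_top (snd_le hr)
  rw [hx] at hs
  obtain ⟨i, hi⟩ := hs
  obtain rfl : t i = s := Subtype.ext (congrArg Prod.fst hi)
  rw [ht'] at hs'
  obtain ⟨j, hj⟩ := hs'
  rw [hu]
  exact ⟨⟨i, j⟩, Prod.ext (Prod.mk.inj hj).1 rfl⟩

/-- The power set of `x` consists of all functions on the domain of `x`: a subset `y` of `x` equals
the function with value `t ∈ y` at `t`. -/
theorem interp_powAx (hκ : κ.IsInaccessible) (hA : #A < κ) :
    𝔸.interp κ Fml.powAx ![] ∈ 𝔸.sep := by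
  refine 𝔸.sep_upward (a := 𝔸.exIntro (𝔸.lam fun h => 𝔸.exIntro (𝔸.pair ⊤
      (𝔸.pair (𝔸.lam fun a => a) (𝔸.lam fun a =>
        𝔸.app (𝔸.app h (𝔸.exIntro (𝔸.pair a 𝔸.reflTm))) (𝔸.lam fun q =>
          𝔸.exIntro (𝔸.pair (𝔸.exIntro (𝔸.pair a (𝔸.symm (𝔸.snd q)))) (𝔸.snd q))))))))
    (mem_sep_of_tracked inferInstance) ?_
  refine le_iInf fun x => ?_
  obtain ⟨ι, t, a, hι, hx⟩ := x.exists_range_eq hκ hA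
  choose y' hy' using fun g : {g : ι → A // ∀ i j, t i = t j → g i = g j} =>
    W.exists_graph hκ.isRegular hι t g.1 g.2
  obtain ⟨z, hz⟩ := W.exists_graph hκ.isRegular
    ((mk_subtype_le _).trans_lt (mk_arrow_lt hκ hι hA)) y' (fun _ => (⊤ : A)) fun _ _ _ => rfl
  refine exIntro_le z (le_iInf fun y => ?_)
  change _ ≤ 𝔸.imp (⨅ s : W A κ, 𝔸.imp (𝔸.memW s.1 y.1) (𝔸.memW s.1 x.1)) (𝔸.memW y.1 z.1)
  refine lam_le fun h hh => ?_
  let g : {g : ι → A // ∀ i j, t i = t j → g i = g j} :=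
    ⟨fun i => 𝔸.memW (t i).1 y.1, fun i j hij => congrArg (fun s : W A κ => 𝔸.memW s.1 y.1) hij⟩
  refine memIntro_le (s := (y' g).1) (a := ⊤) (by rw [hz]; exact ⟨g, rfl⟩) le_rfl
    (pair_le_eqW (fun s b hs => ?_) fun s b hs => lam_le fun c hc => ?_)
  · rw [hy'] at hs
    obtain ⟨i, hi⟩ := hs
    obtain ⟨rfl, rfl⟩ := Prod.mk.inj hi
    exact lam_le fun c hc => hc
  · refine memElimW_le (y := x) (app_le (hh.trans (iInf_le _ (⟨s, y.mem_of_graph hs⟩ : W A κ)))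
      (memIntro_refl_le hs hc)) fun s' b' hs' q hq => ?_
    refine memIntro_le (s := s'.1) (a := 𝔸.memW s'.1 y.1) ?_
      (memIntro_le hs hc (symm_le (snd_le hq))) (snd_le hq)
    rw [hx] at hs'
    obtain ⟨i, hi⟩ := hs'
    obtain rfl : t i = s' := Subtype.ext (congrArg Prod.fst hi)
    rw [hy']
    exact ⟨i, rfl⟩

variable (𝔸) in
/-- The successor of `x` has `x` and the elements of the domain of `x` as arguments. Its value at
`s` is that of the formula `s ∈ x ∨ s = x`: constant values would lose the realizer that decides this
disjunction. -/
theorem exists_succ (hκ : κ.IsInaccessible) (hA : #A < κ) (x : W A κ) :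
    ∃ y : W A κ, y.1.graph = {p | (p.1 = x.1 ∨ Name.InDom p.1 x.1) ∧
      p.2 = 𝔸.plus (𝔸.memW p.1 x.1) (𝔸.eqW p.1 x.1)} := by
  obtain ⟨ι, t, a, hι, hx⟩ := x.exists_range_eq hκ hA
  obtain ⟨y, hy⟩ := W.exists_graph hκ.isRegular (ι := Option ι)
    (by rw [mk_option]; exact add_lt_of_lt hκ.aleph0_lt.le hι (hκ.nat_lt 1 |>.trans_eq' (by simp)))
    (fun i => i.elim x t)
    (fun i => 𝔸.plus (𝔸.memW (i.elim x t).1 x.1) (𝔸.eqW (i.elim x t).1 x.1))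
    fun i j hij => by rw [hij]
  refine ⟨y, hy.trans ?_⟩
  ext ⟨s, b⟩
  constructor
  · rintro ⟨i, hi⟩
    obtain ⟨rfl, rfl⟩ := Prod.mk.inj hi
    refine ⟨?_, rfl⟩
    cases i with
    | none => exact Or.inl rfl
    | some i => exact Or.inr ⟨a i, by rw [hx]; exact ⟨i, rfl⟩⟩
  · rintro ⟨hs, hb⟩
    obtain rfl : b = 𝔸.plus (𝔸.memW s x.1) (𝔸.eqW s x.1) := hb
    obtain rfl | ⟨c, hc⟩ : s = x.1 ∨ Name.InDom s x.1 := hs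
    · exact ⟨none, rfl⟩
    · rw [hx] at hc
      obtain ⟨i, hi⟩ := hc
      obtain ⟨rfl, -⟩ := Prod.mk.inj hi
      exact ⟨some i, rfl⟩

theorem interp_infAx (hκ : κ.IsInaccessible) (hA : #A < κ) :
    𝔸.interp κ Fml.infAx ![] ∈ 𝔸.sep := by
  refine 𝔸.sep_upward (a := 𝔸.exIntro (𝔸.pair
      (𝔸.exIntro (𝔸.pair (𝔸.exIntro (𝔸.pair ⊤ 𝔸.reflTm)) (𝔸.lam fun m => 𝔸.app m ⊤)))
      (𝔸.lam fun m => 𝔸.app m (𝔸.lam fun q => 𝔸.exIntro (𝔸.pair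
        (𝔸.exIntro (𝔸.pair ⊤ 𝔸.reflTm)) (𝔸.pair
        (𝔸.lam fun k => 𝔸.app (𝔸.memCongr 𝔸.reflTm (𝔸.symm (𝔸.snd q)) k) (𝔸.lam fun r =>
          𝔸.exIntro (𝔸.pair (𝔸.inl (𝔸.exIntro (𝔸.pair (𝔸.fst r) 𝔸.reflTm))) (𝔸.snd r))))
        (𝔸.pair (𝔸.exIntro (𝔸.pair (𝔸.inr 𝔸.reflTm) (𝔸.snd q)))
        (𝔸.lam fun k => 𝔸.app k (𝔸.lam fun r => 𝔸.app (𝔸.app (𝔸.fst r)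
          (𝔸.lam fun a => 𝔸.inl (𝔸.memCongr (𝔸.snd r) (𝔸.snd q) a)))
          (𝔸.lam fun b => 𝔸.inr (𝔸.trans (𝔸.symm (𝔸.snd r)) (𝔸.trans b (𝔸.snd q)))))))))))))
    (mem_sep_of_tracked inferInstance) ?_
  obtain ⟨x₀, hx₀⟩ := W.exists_graph_eq_empty (A := A) hκ.isRegular
  choose S hS using exists_succ 𝔸 hκ hA
  -- the numerals, whose set carries the constant value `⊤`
  let N : ℕ → W A κ := fun n => n.rec x₀ fun _ x => S x
  obtain ⟨u, hu⟩ := W.exists_graph hκ.isRegular (ι := ULift ℕ) (by simpa using hκ.aleph0_lt)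
    (fun n => N n.down) (fun _ => (⊤ : A)) fun _ _ _ => rfl
  have hN : ∀ n, ((N n).1, (⊤ : A)) ∈ u.1.graph := fun n => by rw [hu]; exact ⟨⟨n⟩, rfl⟩
  refine exIntro_le u (pair_le (exIntro_le x₀ (pair_le (memIntro_refl_le (hN 0) le_rfl)
    (not_mem_le hx₀))) (le_iInf fun x => lam_le fun m hm => ?_))
  refine memElimW_le (y := u) hm fun s b hs q hq => ?_
  rw [hu] at hs
  obtain ⟨n, hn⟩ := hs
  obtain rfl : N n.down = s := Subtype.ext (congrArg Prod.fst hn)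
  obtain ⟨n⟩ := n
  have hmem : ∀ s : Name A, (s = (N n).1 ∨ Name.InDom s (N n).1) →
      (s, 𝔸.plus (𝔸.memW s (N n).1) (𝔸.eqW s (N n).1)) ∈ (N (n + 1)).1.graph :=
    fun s hs => by
      change _ ∈ (S (N n)).1.graph
      rw [hS]
      exact ⟨hs, rfl⟩
  have he := snd_le hq
  refine exIntro_le (N (n + 1)) (pair_le (memIntro_refl_le (hN (n + 1)) le_rfl)
    (pair_le (le_iInf fun z => lam_le fun k hk => ?_) (pair_le ?_
      (le_iInf fun z => lam_le fun k hk => ?_))))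
  · change k ≤ 𝔸.memW z.1 x.1 at hk
    change _ ≤ 𝔸.memW z.1 (N (n + 1)).1
    refine memElim_le (memCongr_le (reflTm_le _) (symm_le he) hk) fun s b hs r hr => ?_
    exact memIntro_le (hmem s (Or.inr ⟨b, hs⟩)) (inl_le (memIntro_refl_le hs (fst_le hr)))
      (snd_le hr)
  · exact memIntro_le (hmem _ (Or.inl rfl)) (inr_le (reflTm_le _)) he
  · change k ≤ 𝔸.memW z.1 (N (n + 1)).1 at hk
    change _ ≤ 𝔸.plus (𝔸.memW z.1 x.1) (𝔸.eqW z.1 x.1)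
    refine memElim_le hk fun s b hs r hr => ?_
    change (s, b) ∈ (S (N n)).1.graph at hs
    rw [hS] at hs
    obtain rfl : b = 𝔸.plus (𝔸.memW s (N n).1) (𝔸.eqW s (N n).1) := hs.2
    exact case_le (fst_le hr) (lam_le fun c hc => inl_le (memCongr_le (snd_le hr) he hc))
      (lam_le fun c hc => inr_le (trans_le (symm_le (snd_le hr)) (trans_le hc he)))

end ImplicativeAlgebra

namespace ImplicativeAlgebra

variable {A : Type u} [CompleteLattice A] {𝔸 : ImplicativeAlgebra A} {κ : Cardinal.{u}}

/-- The subset of `x` cut out by `φ` has the domain of `x` and the value `x(t) × φ(t)` at `t`. -/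
theorem interp_sepAx (hκ : κ.IsInaccessible) (hA : #A < κ) {n : ℕ} (φ : Fml (n + 2)) :
    𝔸.interp κ (Fml.sepAx φ) ![] ∈ 𝔸.sep := by
  obtain ⟨c, hc, h⟩ := exists_subst_last (𝔸 := 𝔸) (κ := κ) φ
  have := Fact.mk hc
  refine interp_close_mem_sep _ ⟨𝔸.exIntro (𝔸.pair
      (𝔸.lam fun m => 𝔸.app m (𝔸.lam fun q => 𝔸.pair
        (𝔸.exIntro (𝔸.pair (𝔸.fst (𝔸.fst q)) (𝔸.snd q)))
        (𝔸.app (𝔸.app c (𝔸.snd q)) (𝔸.snd (𝔸.fst q)))))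
      (𝔸.lam fun m => 𝔸.lam fun f => 𝔸.app m (𝔸.lam fun q => 𝔸.exIntro (𝔸.pair
        (𝔸.pair (𝔸.fst q) (𝔸.app (𝔸.app c (𝔸.symm (𝔸.snd q))) f)) (𝔸.snd q))))),
    mem_sep_of_tracked inferInstance, fun α => le_iInf fun x => ?_⟩
  obtain ⟨ι, t, a, hι, hx⟩ := x.exists_range_eq hκ hA
  let Φ : W A κ → A := fun z =>
    𝔸.interp κ φ (Fin.snoc (α := fun _ => W A κ) (Fin.snoc (α := fun _ => W A κ) α x) z)
  have hΦ : ∀ s z : W A κ, c ≤ 𝔸.imp (𝔸.eqW s.1 z.1) (𝔸.imp (Φ s) (Φ z)) := h _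
  obtain ⟨y, hy⟩ := W.exists_graph hκ.isRegular hι t (fun i => 𝔸.times (a i) (Φ (t i)))
    fun i j hij => by
      have ha : a i = a j := x.eq_of_graph (t := (t i).1) (by rw [hx]; exact ⟨i, rfl⟩)
        (by rw [hx, hij]; exact ⟨j, rfl⟩)
      rw [ha, hij]
  refine exIntro_le y ?_
  have key : 𝔸.pair
      (𝔸.lam fun m => 𝔸.app m (𝔸.lam fun q => 𝔸.pair
        (𝔸.exIntro (𝔸.pair (𝔸.fst (𝔸.fst q)) (𝔸.snd q)))
        (𝔸.app (𝔸.app c (𝔸.snd q)) (𝔸.snd (𝔸.fst q)))))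
      (𝔸.lam fun m => 𝔸.lam fun f => 𝔸.app m (𝔸.lam fun q => 𝔸.exIntro (𝔸.pair
        (𝔸.pair (𝔸.fst q) (𝔸.app (𝔸.app c (𝔸.symm (𝔸.snd q))) f)) (𝔸.snd q)))) ≤
      𝔸.times (⨅ z : W A κ, 𝔸.imp (𝔸.memW z.1 y.1) (𝔸.times (𝔸.memW z.1 x.1) (Φ z)))
        (⨅ z : W A κ, 𝔸.imp (𝔸.memW z.1 x.1) (𝔸.imp (Φ z) (𝔸.memW z.1 y.1))) := by
    refine pair_le (le_iInf fun z => lam_le fun m hm => ?_)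
      (le_iInf fun z => lam_le fun m hm => lam_le fun f hf => ?_)
    · refine memElimW_le hm fun s b hs q hq => ?_
      rw [hy] at hs
      obtain ⟨i, hi⟩ := hs
      obtain ⟨hi', rfl⟩ := Prod.mk.inj hi
      obtain rfl : t i = s := Subtype.ext hi'
      exact pair_le (memIntro_le (s := (t i).1) (a := a i) (by rw [hx]; exact ⟨i, rfl⟩)
        (fst_le (fst_le hq)) (snd_le hq)) (app_le (app_le (hΦ (t i) z) (snd_le hq))
          (snd_le (fst_le hq)))
    · refine memElimW_le hm fun s b hs q hq => ?_
      rw [hx] at hs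
      obtain ⟨i, hi⟩ := hs
      obtain ⟨hi', rfl⟩ := Prod.mk.inj hi
      obtain rfl : t i = s := Subtype.ext hi'
      exact memIntro_le (s := (t i).1) (a := 𝔸.times (a i) (Φ (t i)))
        (by rw [hy]; exact ⟨i, rfl⟩)
        (pair_le (fst_le hq) (app_le (app_le (hΦ z (t i)) (symm_le (snd_le hq))) hf)) (snd_le hq)
  refine key.trans (le_of_eq ?_)
  simp only [Fml.ball, interp, interp_rename]
  have hsnoc : ∀ z : W A κ, (fun i => Fin.snoc (α := fun _ => W A κ) (Fin.snoc (α := fun _ => W A κ)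
      (Fin.snoc (α := fun _ => W A κ) α x) y) z (Fin.snoc (α := fun _ => Fin (n + 3))
        (Fin.snoc (α := fun _ => Fin (n + 3)) (Fin.castAdd 3) ⟨n, by omega⟩)
          ⟨n + 2, by omega⟩ i)) =
      Fin.snoc (α := fun _ => W A κ) (Fin.snoc (α := fun _ => W A κ) α x) z := by
    intro z
    funext i
    refine Fin.lastCases (by simp [Fin.snoc])
      (fun i => Fin.lastCases (by simp [Fin.snoc]) (fun i => ?_) i) i
    have hi : (i : ℕ) ≤ n + 1 := by omega
    simp [Fin.snoc, hi]
    rfl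
  simp only [hsnoc]
  simp [Fin.snoc, Φ]

theorem interp_colAx (hκ : κ.IsInaccessible) (hA : #A < κ) {n : ℕ} (φ : Fml (n + 3)) :
    𝔸.interp κ (Fml.colAx φ) ![] ∈ 𝔸.sep := by
  obtain ⟨c, hc, h⟩ := exists_subst (𝔸 := 𝔸) (κ := κ) φ ⟨n, by omega⟩
  have := Fact.mk hc
  refine interp_close_mem_sep _ ⟨𝔸.lam fun h => 𝔸.exIntro (𝔸.lam fun m => 𝔸.app m (𝔸.lam fun q =>
      𝔸.app (𝔸.app h (𝔸.exIntro (𝔸.pair (𝔸.fst q) 𝔸.reflTm))) (𝔸.lam fun r =>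
        𝔸.exIntro (𝔸.pair (𝔸.exIntro (𝔸.pair ⊤ 𝔸.reflTm)) (𝔸.app (𝔸.app c (𝔸.snd q)) r))))),
    mem_sep_of_tracked inferInstance, fun α => le_iInf fun y => ?_⟩
  obtain ⟨ι, t, a, hι, hy⟩ := y.exists_range_eq hκ hA
  let Φ : W A κ → W A κ → A := fun x z =>
    𝔸.interp κ φ (Fin.snoc (α := fun _ => W A κ) (Fin.snoc (α := fun _ => W A κ)
      (Fin.snoc (α := fun _ => W A κ) α x) y) z)
  have hΦ : ∀ x x' z : W A κ, c ≤ 𝔸.imp (𝔸.eqW x.1 x'.1) (𝔸.imp (Φ x z) (Φ x' z)) := by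
    intro x x' z
    have h' := h (Fin.snoc (α := fun _ => W A κ) (Fin.snoc (α := fun _ => W A κ)
      (Fin.snoc (α := fun _ => W A κ) α x) y) z) x'
    have h₁ : Function.update (Fin.snoc (α := fun _ => W A κ) (Fin.snoc (α := fun _ => W A κ)
        (Fin.snoc (α := fun _ => W A κ) α x) y) z) ⟨n, by omega⟩ x' =
        Fin.snoc (α := fun _ => W A κ) (Fin.snoc (α := fun _ => W A κ)
          (Fin.snoc (α := fun _ => W A κ) α x') y) z := by
      rw [← Fin.update_snoc_last (α := fun _ => W A κ) x α x', Fin.snoc_update, Fin.snoc_update]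
      rfl
    rw [h₁] at h'
    simpa [Fin.snoc] using h'
  -- for each `t` in the domain of `y`, one witness for each of the fewer than `κ` truth values
  choose z hz using fun p : {p : ι × A // ∃ z, Φ (t p.1) z = p.2} => p.2
  obtain ⟨u, hu⟩ := W.exists_graph hκ.isRegular ((mk_subtype_le _).trans_lt
    (by rw [mk_prod, lift_id, lift_id]; exact mul_lt_of_lt hκ.aleph0_lt.le hι hA)) z
    (fun _ => (⊤ : A)) fun _ _ _ => rfl
  have key : 𝔸.lam (fun h => 𝔸.exIntro (𝔸.lam fun m => 𝔸.app m (𝔸.lam fun q =>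
      𝔸.app (𝔸.app h (𝔸.exIntro (𝔸.pair (𝔸.fst q) 𝔸.reflTm))) (𝔸.lam fun r =>
        𝔸.exIntro (𝔸.pair (𝔸.exIntro (𝔸.pair ⊤ 𝔸.reflTm)) (𝔸.app (𝔸.app c (𝔸.snd q)) r)))))) ≤
      𝔸.imp (⨅ x : W A κ, 𝔸.imp (𝔸.memW x.1 y.1) (𝔸.exist (Φ x)))
        (𝔸.exist fun u : W A κ => ⨅ x : W A κ, 𝔸.imp (𝔸.memW x.1 y.1)
          (𝔸.exist fun z : W A κ => 𝔸.times (𝔸.memW z.1 u.1) (Φ x z))) := by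
    refine lam_le fun h hh => exIntro_le u (le_iInf fun x => lam_le fun m hm => ?_)
    refine memElimW_le hm fun s b hs q hq => ?_
    refine exElim_le (app_le (hh.trans (iInf_le _ s)) (memIntro_refl_le hs (fst_le hq)))
      fun z' => lam_le fun r hr => ?_
    rw [hy] at hs
    obtain ⟨i, hi⟩ := hs
    obtain rfl : t i = s := Subtype.ext (Prod.mk.inj hi).1
    let p : {p : ι × A // ∃ z, Φ (t p.1) z = p.2} := ⟨(i, Φ (t i) z'), z', rfl⟩
    exact exIntro_le (z p) (pair_le (memIntro_refl_le (s := (z p).1) (a := ⊤)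
      (by rw [hu]; exact ⟨p, rfl⟩) le_rfl) (app_le (app_le (hΦ (t i) x (z p)) (snd_le hq))
        (hr.trans (hz p).ge)))
  refine key.trans (le_of_eq ?_)
  simp only [Fml.ball, Fml.bex, interp, interp_rename]
  have hsnoc : ∀ x z : W A κ, (fun i => Fin.snoc (α := fun _ => W A κ)
      (Fin.snoc (α := fun _ => W A κ) (Fin.snoc (α := fun _ => W A κ) α y) x) z
      (Fin.snoc (α := fun _ => Fin (n + 3)) (Fin.snoc (α := fun _ => Fin (n + 3))
        (Fin.snoc (α := fun _ => Fin (n + 3)) (Fin.castAdd 3) ⟨n + 1, by omega⟩) ⟨n, by omega⟩)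
          ⟨n + 2, by omega⟩ i)) = Fin.snoc (α := fun _ => W A κ) (Fin.snoc (α := fun _ => W A κ)
            (Fin.snoc (α := fun _ => W A κ) α x) y) z := by
    intro x z
    funext i
    refine Fin.lastCases (by simp [Fin.snoc]) (fun i => Fin.lastCases (by simp [Fin.snoc])
      (fun i => Fin.lastCases (by simp [Fin.snoc]) (fun i => ?_) i) i) i
    have hi : (i : ℕ) ≤ n + 1 := by omega
    simp [Fin.snoc, hi]
    rfl
  have hsnoc' : ∀ u x z : W A κ, (fun i => Fin.snoc (α := fun _ => W A κ)
      (Fin.snoc (α := fun _ => W A κ) (Fin.snoc (α := fun _ => W A κ)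
        (Fin.snoc (α := fun _ => W A κ) α y) u) x) z
      (Fin.snoc (α := fun _ => Fin (n + 4)) (Fin.snoc (α := fun _ => Fin (n + 4))
        (Fin.snoc (α := fun _ => Fin (n + 4)) (Fin.castAdd 4) ⟨n + 2, by omega⟩) ⟨n, by omega⟩)
          ⟨n + 3, by omega⟩ i)) = Fin.snoc (α := fun _ => W A κ) (Fin.snoc (α := fun _ => W A κ)
            (Fin.snoc (α := fun _ => W A κ) α x) y) z := by
    intro u x z
    funext i
    refine Fin.lastCases (by simp [Fin.snoc]) (fun i => Fin.lastCases (by simp [Fin.snoc]; omega)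
      (fun i => Fin.lastCases (by simp [Fin.snoc]) (fun i => ?_) i) i) i
    have hi : (i : ℕ) ≤ n + 1 := by omega
    have hi' : (i : ℕ) ≤ n + 2 := by omega
    simp [Fin.snoc, hi, hi']
    rfl
  simp only [hsnoc, hsnoc']
  simp [Fin.snoc, Φ]

/-- The induction hypothesis is obtained from the same realizer `r` for all elements of the domain,
so that the realizer of the scheme is a fixed point. -/
theorem interp_indAx {n : ℕ} (φ : Fml (n + 1)) : 𝔸.interp κ (Fml.indAx φ) ![] ∈ 𝔸.sep := by
  obtain ⟨c, hc, h⟩ := exists_subst_last (𝔸 := 𝔸) (κ := κ) φ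
  have := Fact.mk hc
  refine interp_close_mem_sep _ ⟨𝔸.lam fun h => 𝔸.fix (𝔸.lam fun r => 𝔸.app h (𝔸.lam fun m =>
      𝔸.app m (𝔸.lam fun q => 𝔸.app (𝔸.app c (𝔸.snd q)) r))),
    mem_sep_of_tracked inferInstance, fun α => ?_⟩
  let Φ : W A κ → A := fun x => 𝔸.interp κ φ (Fin.snoc (α := fun _ => W A κ) α x)
  have hΦ : ∀ s z : W A κ, c ≤ 𝔸.imp (𝔸.eqW s.1 z.1) (𝔸.imp (Φ s) (Φ z)) := h _
  have key : 𝔸.lam (fun h => 𝔸.fix (𝔸.lam fun r => 𝔸.app h (𝔸.lam fun m =>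
      𝔸.app m (𝔸.lam fun q => 𝔸.app (𝔸.app c (𝔸.snd q)) r)))) ≤
      𝔸.imp (⨅ x : W A κ, 𝔸.imp (⨅ y : W A κ, 𝔸.imp (𝔸.memW y.1 x.1) (Φ y)) (Φ x))
        (⨅ x : W A κ, Φ x) := by
    refine lam_le fun h hh => le_iInf fun x => ?_
    refine (fix_le_of_inDom (φ := fun x => ⨅ hx, Φ ⟨x, hx⟩) (fun x r hr => (beta _ _).trans
      (le_iInf fun hx => ?_)) x.1).trans (iInf_le _ x.2)
    refine app_le (hh.trans (iInf_le _ (⟨x, hx⟩ : W A κ))) (le_iInf fun y => lam_le fun m hm => ?_)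
    exact memElimW_le hm fun s a hs q hq => app_le (app_le (hΦ s y) (snd_le hq))
      ((hr s.1 ⟨a, hs⟩).trans (iInf_le _ s.2))
  refine key.trans (le_of_eq ?_)
  simp only [Fml.ball, interp, interp_rename]
  have hsnoc : ∀ x y : W A κ, (fun i => Fin.snoc (α := fun _ => W A κ)
      (Fin.snoc (α := fun _ => W A κ) α x) y (Fin.snoc (α := fun _ => Fin (n + 2))
        (Fin.castAdd 2) ⟨n + 1, by omega⟩ i)) = Fin.snoc (α := fun _ => W A κ) α y := by
    intro x y
    funext i
    refine Fin.lastCases (by simp [Fin.snoc]) (fun i => ?_) i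
    simp [Fin.snoc]
    rfl
  simp only [hsnoc]
  simp [Fin.snoc, Φ]

theorem interp_mem_sep_of_izfAxiom (hκ : κ.IsInaccessible) (hA : #A < κ) {ψ : Fml 0}
    (hψ : IZFAxiom ψ) : 𝔸.interp κ ψ ![] ∈ 𝔸.sep := by
  cases hψ with
  | empty => exact interp_emptyAx hκ.isRegular
  | ext => exact interp_extAx
  | pair => exact interp_pairAx hκ
  | union => exact interp_unionAx hκ hA
  | pow => exact interp_powAx hκ hA
  | inf => exact interp_infAx hκ hA
  | sep φ => exact interp_sepAx hκ hA φ
  | col φ => exact interp_colAx hκ hA φ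
  | ind φ => exact interp_indAx φ

end ImplicativeAlgebra

/-! ### Heyting-valued models -/

namespace HeytingValued

variable {H : Type u} [Order.Frame H]

theorem imp_eq (a b : H) : (heytingImplicative H).imp a b = a ⇨ b := rfl

theorem times_eq (a b : H) : (heytingImplicative H).times a b = a ⊓ b := by
  refine le_antisymm ?_ (le_iInf fun x => ?_)
  · refine (iInf_le _ (a ⊓ b)).trans ?_
    rw [imp_eq, imp_eq, imp_eq, himp_himp, himp_self, top_himp]
  · rw [imp_eq, imp_eq, imp_eq, himp_himp, le_himp_iff]
    exact inf_himp_le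

theorem exist_eq {I : Type v} (a : I → H) : (heytingImplicative H).exist a = ⨆ i, a i := by
  refine le_antisymm ?_ (iSup_le fun i => le_iInf fun x => ?_)
  · refine (iInf_le _ (⨆ i, a i)).trans ?_
    have h : (⨅ i, (heytingImplicative H).imp (a i) (⨆ i, a i)) = ⊤ :=
      iInf_eq_top.2 fun i => himp_eq_top_iff.2 (le_iSup a i)
    rw [h, imp_eq, top_himp]
  · rw [imp_eq, le_himp_iff]
    exact (inf_le_inf le_rfl (iInf_le _ i)).trans inf_himp_le

theorem plus_eq (a b : H) : (heytingImplicative H).plus a b = a ⊔ b := by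
  refine le_antisymm ?_ (sup_le (le_iInf fun x => ?_) (le_iInf fun x => ?_))
  · refine (iInf_le _ (a ⊔ b)).trans ?_
    rw [imp_eq, imp_eq, imp_eq, imp_eq, himp_eq_top_iff.2 le_sup_left,
      himp_eq_top_iff.2 le_sup_right, top_himp, top_himp]
  · rw [imp_eq, imp_eq, imp_eq, imp_eq, le_himp_iff, le_himp_iff]
    exact inf_le_left.trans inf_himp_le
  · rw [imp_eq, imp_eq, imp_eq, imp_eq, le_himp_iff, le_himp_iff]
    exact (inf_le_inf inf_le_left le_rfl).trans inf_himp_le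

theorem eq_symm (x y : Name H) : eq x y = eq y x := by
  rw [eq, eq, inf_comm]

theorem eqW_symm (x y : Name H) :
    (heytingImplicative H).eqW x y = (heytingImplicative H).eqW y x := by
  rw [ImplicativeAlgebra.eqW, ImplicativeAlgebra.eqW, times_eq, times_eq, inf_comm]

theorem eqW_eq (x y : Name H) : (heytingImplicative H).eqW x y = eq x y := by
  induction x using Name.inDom_wf.induction generalizing y with
  | _ x ih =>
  have h₁ : ∀ p : x.graph, (heytingImplicative H).memW p.1.1 y = mem p.1.1 y := fun p => by
    rw [ImplicativeAlgebra.memW, mem, exist_eq]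
    refine iSup_congr fun q => ?_
    rw [times_eq, eqW_symm, ih p.1.1 ⟨_, p.2⟩]
  have h₂ : ∀ q : y.graph, (heytingImplicative H).memW q.1.1 x = mem q.1.1 x := fun q => by
    rw [ImplicativeAlgebra.memW, mem, exist_eq]
    refine iSup_congr fun p => ?_
    rw [times_eq, ih p.1.1 ⟨_, p.2⟩, eq_symm]
  rw [ImplicativeAlgebra.eqW, eq, times_eq]
  simp only [h₁, h₂, imp_eq]

theorem memW_eq (x y : Name H) : (heytingImplicative H).memW x y = mem x y := by
  rw [ImplicativeAlgebra.memW, mem, exist_eq]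
  refine iSup_congr fun q => ?_
  rw [times_eq, eqW_eq, eq_symm]

theorem interp_eq {κ : Cardinal.{u}} {n : ℕ} (φ : Fml n) (α : Fin n → W H κ) :
    (heytingImplicative H).interp κ φ α = interp κ φ α := by
  induction φ with
  | bot => rfl
  | mem i j => exact memW_eq _ _
  | eq i j => exact eqW_eq _ _
  | and φ ψ ihφ ihψ => simp only [ImplicativeAlgebra.interp, interp, times_eq, ihφ, ihψ]
  | or φ ψ ihφ ihψ => simp only [ImplicativeAlgebra.interp, interp, plus_eq, ihφ, ihψ]
  | imp φ ψ ihφ ihψ => simp only [ImplicativeAlgebra.interp, interp, imp_eq, ihφ, ihψ]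
  | ex φ ih => simp only [ImplicativeAlgebra.interp, interp, exist_eq, ih]
  | all φ ih => simp only [ImplicativeAlgebra.interp, interp, ih]

end HeytingValued

/-! ### Realizability models -/

namespace Name

variable {R : Type u}

/-- The labelled set that reads a partial function `x` as the set of pairs `(t, r)` with `r ∈ x(t)`,
hereditarily. -/
noncomputable def collapse (x : Name (Set R)) : Name R :=
  (exists_graph_eq (Set.range fun q : Σ p : x.graph, p.1.2 => (collapse q.1.1.1, q.2.1))).choose
termination_by inDom_wf.wrap x
decreasing_by all_goals exact ⟨q.1.1.2, q.1.2⟩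

theorem mem_graph_collapse {x : Name (Set R)} {p : Name R × R} :
    p ∈ x.collapse.graph ↔ ∃ t X, (t, X) ∈ x.graph ∧ p.2 ∈ X ∧ p.1 = t.collapse := by
  rw [collapse, (exists_graph_eq _).choose_spec]
  constructor
  · rintro ⟨⟨q, r⟩, rfl⟩
    exact ⟨_, _, q.2, r.2, rfl⟩
  · rintro ⟨t, X, h, hp, hp'⟩
    exact ⟨⟨⟨(t, X), h⟩, ⟨p.2, hp⟩⟩, Prod.ext hp'.symm rfl⟩

theorem collapse_mem_hierarchy {β : Ordinal.{u}} {x : Name (Set R)}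
    (hx : x ∈ hierarchy part β) : x.collapse ∈ hierarchy pow β := by
  induction β using WellFoundedLT.induction generalizing x with
  | ind β ih =>
  obtain ⟨γ, hγ, hx⟩ := (mem_hierarchy_iff part_mono).1 hx
  refine (mem_hierarchy_iff pow_mono).2 ⟨γ, hγ, fun t a ht => ?_⟩
  obtain ⟨s, X, hs, -, rfl⟩ := mem_graph_collapse.1 ht
  exact ih γ hγ (hx.1 _ _ hs)

theorem exists_collapse_eq {β : Ordinal.{u}} {v : Name R} (hv : v ∈ hierarchy pow β) :
    ∃ x ∈ hierarchy part β, collapse x = v := by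
  induction β using WellFoundedLT.induction generalizing v with
  | ind β ih =>
  obtain ⟨γ, hγ, hv⟩ := (mem_hierarchy_iff pow_mono).1 hv
  have : Nonempty (Name (Set R)) := ⟨(exists_graph_eq ∅).choose⟩
  choose! g hg hgc using fun w (hw : w ∈ hierarchy pow γ) => ih γ hγ (v := w) hw
  obtain ⟨x, hx⟩ := exists_graph_eq
    (Set.range fun p : v.graph => (g p.1.1, {r | (p.1.1, r) ∈ v.graph}))
  have hgraph : ∀ w r, (w, r) ∈ v.graph → collapse (g w) = w := fun w r h => hgc w (hv w r h)
  refine ⟨x, (mem_hierarchy_iff part_mono).2 ⟨γ, hγ, ?_, ?_⟩, graph_injective ?_⟩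
  · intro t X h
    rw [hx] at h
    obtain ⟨p, hp⟩ := h
    rw [← (Prod.mk.inj hp).1]
    exact hg _ (hv _ _ p.2)
  · intro t X Y h h'
    rw [hx] at h h'
    obtain ⟨p, hp⟩ := h
    obtain ⟨q, hq⟩ := h'
    have e : g p.1.1 = g q.1.1 := (Prod.mk.inj hp).1.trans (Prod.mk.inj hq).1.symm
    have e' : p.1.1 = q.1.1 := by
      rw [← hgraph _ _ p.2, e, hgraph _ _ q.2]
    rw [← (Prod.mk.inj hp).2, ← (Prod.mk.inj hq).2, e']
  · ext ⟨w, r⟩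
    rw [mem_graph_collapse, hx]
    constructor
    · rintro ⟨t, X, ⟨p, hp⟩, hr, hw⟩
      obtain ⟨rfl, rfl⟩ := Prod.mk.inj hp
      obtain rfl : w = p.1.1 := hw.trans (hgraph _ _ p.2)
      exact hr
    · intro h
      exact ⟨_, _, ⟨⟨(w, r), h⟩, rfl⟩, h, (hgraph _ _ h).symm⟩

end Name

namespace Realizability

open CombinatoryAlgebra ImplicativeAlgebra

variable {R : Type u}

/-- The surjection of `W` onto `V`. -/
noncomputable def toV (κ : Cardinal.{u}) (x : W (Set R) κ) : V R κ :=
  ⟨x.1.collapse, Name.collapse_mem_hierarchy x.2⟩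

theorem toV_surjective (κ : Cardinal.{u}) : Function.Surjective (toV (R := R) κ) := by
  intro v
  obtain ⟨x, hx, h⟩ := Name.exists_collapse_eq v.2
  exact ⟨⟨x, hx⟩, Subtype.ext h⟩

theorem toV_snoc (κ : Cardinal.{u}) {n : ℕ} (α : Fin n → W (Set R) κ) (β : W (Set R) κ) :
    (fun i => toV κ (Fin.snoc (α := fun _ => W (Set R) κ) α β i)) =
      Fin.snoc (α := fun _ => V R κ) (fun i => toV κ (α i)) (toV κ β) := by
  funext i
  refine Fin.lastCases ?_ (fun i => ?_) i <;> simp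

variable [CombinatoryAlgebra R]

variable (R) in
/-- The implicative algebra of a total combinatory algebra. -/
noncomputable abbrev alg : ImplicativeAlgebra (Set R) := realizabilityImplicative R

/-- Realizers of a conjunction, coded as pairs. -/
def prod (X Y : Set R) : Set R := {r | fst r ∈ X ∧ snd r ∈ Y}

/-- Realizers of a disjunction, coded as labelled elements. -/
def sum (X Y : Set R) : Set R := {r | (fst r = k ∧ snd r ∈ X) ∨ (fst r = kbar ∧ snd r ∈ Y)}

theorem mem_sep_iff {X : Set R} : X ∈ (alg R).sep ↔ X.Nonempty :=
  Set.nonempty_iff_ne_empty.symm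

theorem singleton_mem_sep (r : R) : ({r} : Set R) ∈ (alg R).sep :=
  mem_sep_iff.2 (Set.singleton_nonempty r)

theorem app_singleton_le {a b : R} : (alg R).app {a} {b} ≤ ({app a b} : Set R) :=
  app_le_iff.2 (by rintro _ rfl _ rfl; rfl)

theorem app_mem_of_mem_lam {r : R} {f : Set R → Set R} (h : r ∈ (alg R).lam f) (a : R) :
    app r a ∈ f {a} :=
  Set.mem_iInter.1 h {a} a rfl

/-- A union is also the existential quantifier on realizers: a realizer of all `a i → C` realizes
`Y → C` for `Y` covered by the sets `a i`. -/
theorem le_imp_of_cover {I : Type v} {a : I → Set R} {X C Y : Set R}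
    (hY : ∀ r ∈ Y, ∃ i, r ∈ a i) (h : ∀ i, X ≤ (alg R).imp (a i) C) : X ≤ (alg R).imp Y C := by
  intro x hx r hr
  obtain ⟨i, hi⟩ := hY r hr
  exact h i hx r hi

variable (R) in
theorem exists_prod_intro :
    ∃ c ∈ (alg R).sep, ∀ X Y : Set R, c ≤ (alg R).imp X ((alg R).imp Y (prod X Y)) := by
  -- on singletons, the elements of this term compute as `λ a b z. z a b` does
  refine ⟨(alg R).lam fun a => (alg R).lam fun b => (alg R).lam fun z =>
    (alg R).app ((alg R).app z a) b, mem_sep_of_tracked inferInstance, fun X Y r hr a ha b hb => ?_⟩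
  have h : ∀ z, app (app (app r a) b) z = app (app z a) b := fun z =>
    ((app_mono app_singleton_le le_rfl).trans app_singleton_le)
      (app_mem_of_mem_lam (app_mem_of_mem_lam (app_mem_of_mem_lam hr a) b) z)
  refine ⟨?_, ?_⟩
  · rw [CombinatoryAlgebra.fst, h, app_k]
    exact ha
  · rw [CombinatoryAlgebra.snd, h, kbar, app_k, app_s, app_k]
    exact hb

variable (R) in
theorem exists_times_imp_prod :
    ∃ c ∈ (alg R).sep, ∀ X Y : Set R, c ≤ (alg R).imp ((alg R).times X Y) (prod X Y) := by
  obtain ⟨c, hc, h⟩ := exists_prod_intro R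
  have := Fact.mk hc
  exact ⟨(alg R).lam fun t => (alg R).app ((alg R).app c ((alg R).fst t)) ((alg R).snd t),
    mem_sep_of_tracked inferInstance, fun X Y => lam_le fun t ht =>
      app_le (app_le (h X Y) (fst_le ht)) (snd_le ht)⟩

variable (R) in
/-- The element `s (s k k) (k b)` applies its argument to `b`. -/
theorem exists_app_eq (b : R) : ∃ c ∈ (alg R).sep, ∀ r ∈ c, ∀ a : R, app r a = app a b := by
  refine ⟨{app (app s (app (app s k) k)) (app k b)}, singleton_mem_sep _, ?_⟩
  rintro _ rfl a
  rw [app_s, app_s, app_k, app_k]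

variable (R) in
theorem exists_prod_imp_times :
    ∃ c ∈ (alg R).sep, ∀ X Y : Set R, c ≤ (alg R).imp (prod X Y) ((alg R).times X Y) := by
  obtain ⟨c, hc, h⟩ := exists_app_eq R k
  obtain ⟨d, hd, h'⟩ := exists_app_eq R kbar
  have := Fact.mk hc
  have := Fact.mk hd
  refine ⟨(alg R).lam fun t => (alg R).pair ((alg R).app c t) ((alg R).app d t),
    mem_sep_of_tracked inferInstance, fun X Y => lam_le fun t ht => pair_le ?_ ?_⟩
  · refine app_le (a := prod X Y) (fun r hr a ha => ?_) ht
    rw [h r hr]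
    exact ha.1
  · refine app_le (a := prod X Y) (fun r hr a ha => ?_) ht
    rw [h' r hr]
    exact ha.2

variable (R) in
theorem exists_plus_imp_sum :
    ∃ c ∈ (alg R).sep, ∀ X Y : Set R, c ≤ (alg R).imp ((alg R).plus X Y) (sum X Y) := by
  obtain ⟨c, hc, h⟩ := exists_prod_intro R
  have := Fact.mk hc
  have := Fact.mk (singleton_mem_sep (k : R))
  have := Fact.mk (singleton_mem_sep (kbar : R))
  refine ⟨(alg R).lam fun t => (alg R).app
      ((alg R).app t ((alg R).lam fun a => (alg R).app ((alg R).app c {k}) a))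
      ((alg R).lam fun b => (alg R).app ((alg R).app c {kbar}) b),
    by exact mem_sep_of_tracked inferInstance, fun X Y => lam_le fun t ht =>
      case_le ht (lam_le fun a ha => ?_) (lam_le fun b hb => ?_)⟩
  · exact (app_le (app_le (h {k} X) le_rfl) ha).trans fun r hr => Or.inl hr
  · exact (app_le (app_le (h {kbar} Y) le_rfl) hb).trans fun r hr => Or.inr hr

variable (R) in
/-- The label of a realizer of the disjunction is a combinator that selects the branch. -/
theorem exists_sum_imp_plus :
    ∃ c ∈ (alg R).sep, ∀ X Y : Set R, c ≤ (alg R).imp (sum X Y) ((alg R).plus X Y) := by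
  obtain ⟨c, hc, h⟩ := exists_app_eq R k
  obtain ⟨d, hd, h'⟩ := exists_app_eq R kbar
  have := Fact.mk hc
  have := Fact.mk hd
  refine ⟨(alg R).lam fun t => (alg R).lam fun f => (alg R).lam fun g =>
      (alg R).app ((alg R).app ((alg R).app c t) ((alg R).app f ((alg R).app d t)))
        ((alg R).app g ((alg R).app d t)),
    mem_sep_of_tracked inferInstance, fun X Y => ?_⟩
  refine le_imp_of_cover (a := fun r : sum X Y => {r.1}) (fun r hr => ⟨⟨r, hr⟩, rfl⟩)
    fun ⟨r, hr⟩ => lam_le fun t ht => le_iInf fun Z => lam_le fun f hf => lam_le fun g hg => ?_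
  have hd : (alg R).app d t ≤ {snd r} := app_le (a := {r}) (by
    rintro p hp _ rfl
    exact h' p hp _) ht
  have hc : (alg R).app c t ≤ {fst r} := app_le (a := {r}) (by
    rintro p hp _ rfl
    exact h p hp _) ht
  obtain ⟨hk, hX⟩ | ⟨hk, hY⟩ := hr
  · rw [hk] at hc
    have hZ : (alg R).app f ((alg R).app d t) ≤ Z :=
      app_le hf (hd.trans (Set.singleton_subset_iff.2 hX))
    refine app_le (a := ⊤) (app_le (a := Z) (hc.trans ?_) hZ) le_top
    rintro _ rfl a ha b -
    rw [app_k]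
    exact ha
  · rw [hk] at hc
    have hZ : (alg R).app g ((alg R).app d t) ≤ Z :=
      app_le hg (hd.trans (Set.singleton_subset_iff.2 hY))
    refine app_le (a := Z) (app_le (a := ⊤) (hc.trans ?_) le_top) hZ
    rintro _ rfl a - b hb
    rw [kbar, app_k, app_s, app_k]
    exact hb

theorem mem_collapse (x : Name R) (y : Name (Set R)) : mem x y.collapse =
    ⋃ q : y.graph, prod q.1.2 (eq x q.1.1.collapse) := by
  ext r
  rw [mem, Set.mem_iUnion]
  constructor
  · rintro ⟨⟨p, hp⟩, h, h'⟩
    obtain ⟨t, X, ht, hX, hp⟩ := Name.mem_graph_collapse.1 hp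
    refine ⟨⟨(t, X), ht⟩, ?_, ?_⟩
    · rw [h]
      exact hX
    · rw [← hp]
      exact h'
  · rintro ⟨⟨q, hq⟩, h, h'⟩
    exact ⟨⟨(q.1.collapse, fst r), Name.mem_graph_collapse.2 ⟨_, _, hq, h, rfl⟩⟩, rfl, h'⟩

theorem eq_eq_prod (x y : Name R) : eq x y =
    prod {r | ∀ p : x.graph, app r p.1.2 ∈ mem p.1.1 y}
      {r | ∀ p : y.graph, app r p.1.2 ∈ mem p.1.1 x} := by
  rw [eq]
  rfl

theorem setOf_forall_collapse (x : Name (Set R)) (y : Name R) :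
    {r : R | ∀ p : x.collapse.graph, app r p.1.2 ∈ mem p.1.1 y} =
      ⨅ p : x.graph, (alg R).imp p.1.2 (mem p.1.1.collapse y) := by
  ext r
  rw [Set.iInf_eq_iInter, Set.mem_iInter]
  constructor
  · intro h q a ha
    exact h ⟨(q.1.1.collapse, a), Name.mem_graph_collapse.2 ⟨_, _, q.2, ha, rfl⟩⟩
  · rintro h ⟨p, hp⟩
    obtain ⟨t, X, ht, hX, hp⟩ := Name.mem_graph_collapse.1 hp
    change app r p.2 ∈ mem p.1 y
    rw [hp]
    exact h ⟨(t, X), ht⟩ _ hX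

theorem eq_collapse (x y : Name (Set R)) : eq x.collapse y.collapse =
    prod (⨅ p : x.graph, (alg R).imp p.1.2 (mem p.1.1.collapse y.collapse))
      (⨅ p : y.graph, (alg R).imp p.1.2 (mem p.1.1.collapse x.collapse)) := by
  rw [eq_eq_prod, setOf_forall_collapse, setOf_forall_collapse]

variable (R) in
theorem exists_eq_symm :
    ∃ c ∈ (alg R).sep, ∀ x y : Name R, c ≤ (alg R).imp (eq x y) (eq y x) := by
  obtain ⟨c, hc, h⟩ := exists_prod_imp_times R
  obtain ⟨d, hd, h'⟩ := exists_times_imp_prod R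
  have := Fact.mk hc
  have := Fact.mk hd
  refine ⟨(alg R).lam fun t => (alg R).app d ((alg R).pair ((alg R).snd ((alg R).app c t))
      ((alg R).fst ((alg R).app c t))), mem_sep_of_tracked inferInstance, fun x y => ?_⟩
  rw [eq_eq_prod x y, eq_eq_prod y x]
  exact lam_le fun t ht => app_le (h' _ _)
    (pair_le (snd_le (app_le (h _ _) ht)) (fst_le (app_le (h _ _) ht)))

variable (R) in
/-- The two interpretations of equality are equivalent, by a realizer that is uniform in the names.
Both directions come from one recursion on the first name. -/
theorem exists_eq_equiv : ∃ c ∈ (alg R).sep, ∀ x y : Name (Set R), c ≤ (alg R).times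
    ((alg R).imp ((alg R).eqW x y) (eq x.collapse y.collapse))
    ((alg R).imp (eq x.collapse y.collapse) ((alg R).eqW x y)) := by
  obtain ⟨c, hc, h⟩ := exists_prod_imp_times R
  obtain ⟨d, hd, h'⟩ := exists_times_imp_prod R
  obtain ⟨e, he, hsymm⟩ := exists_eq_symm R
  have := Fact.mk hc
  have := Fact.mk hd
  have := Fact.mk he
  refine ⟨(alg R).fix ((alg R).lam fun r => (alg R).pair
      ((alg R).lam fun h => (alg R).app d ((alg R).pair
        ((alg R).lam fun a => (alg R).app ((alg R).app ((alg R).fst h) a) ((alg R).lam fun m =>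
          (alg R).app d ((alg R).pair ((alg R).fst m)
            ((alg R).app ((alg R).fst r) ((alg R).symm ((alg R).snd m))))))
        ((alg R).lam fun a => (alg R).app ((alg R).app ((alg R).snd h) a) ((alg R).lam fun m =>
          (alg R).app d ((alg R).pair ((alg R).fst m)
            ((alg R).app e ((alg R).app ((alg R).fst r) ((alg R).snd m))))))))
      ((alg R).lam fun h => (alg R).pair
        ((alg R).lam fun a => (alg R).app ((alg R).lam fun m => (alg R).exIntro ((alg R).pair
            ((alg R).fst ((alg R).app c m)) ((alg R).symm ((alg R).app ((alg R).snd r)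
              ((alg R).snd ((alg R).app c m))))))
          ((alg R).app ((alg R).fst ((alg R).app c h)) a))
        ((alg R).lam fun a => (alg R).app ((alg R).lam fun m => (alg R).exIntro ((alg R).pair
            ((alg R).fst ((alg R).app c m)) ((alg R).app ((alg R).snd r)
              ((alg R).app e ((alg R).snd ((alg R).app c m))))))
          ((alg R).app ((alg R).snd ((alg R).app c h)) a)))),
    mem_sep_of_tracked inferInstance, fun x y => ?_⟩
  refine (fix_le_of_inDom (φ := fun x => ⨅ y : Name (Set R), (alg R).times
    ((alg R).imp ((alg R).eqW x y) (eq x.collapse y.collapse))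
    ((alg R).imp (eq x.collapse y.collapse) ((alg R).eqW x y)))
    (fun x r hr => (beta _ _).trans (le_iInf fun y => ?_)) x).trans (iInf_le _ y)
  have hr' : ∀ p : x.graph, ∀ z : Name (Set R), r ≤ (alg R).times
      ((alg R).imp ((alg R).eqW p.1.1 z) (eq p.1.1.collapse z.collapse))
      ((alg R).imp (eq p.1.1.collapse z.collapse) ((alg R).eqW p.1.1 z)) :=
    fun p z => (hr p.1.1 ⟨_, p.2⟩).trans (iInf_le _ z)
  rw [eq_collapse]
  refine pair_le (lam_le fun f hf => app_le (h' _ _) (pair_le ?_ ?_))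
    (lam_le fun f hf => pair_le_eqW ?_ ?_)
  · refine le_iInf fun p => lam_le fun a ha => memElim_le (app_fst_le hf p.2 ha) ?_
    intro s b hs m hm
    rw [mem_collapse]
    exact (app_le (h' _ _) (pair_le (fst_le hm) (app_le (fst_le (hr' p s))
      (symm_le (snd_le hm))))).trans
        (Set.subset_iUnion (fun q : y.graph => prod q.1.2 (eq p.1.1.collapse q.1.1.collapse))
          ⟨(s, b), hs⟩)
  · refine le_iInf fun p => lam_le fun a ha => memElim_le (app_snd_le hf p.2 ha) ?_
    intro s b hs m hm
    rw [mem_collapse]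
    exact (app_le (h' _ _) (pair_le (fst_le hm) (app_le (hsymm _ _)
      (app_le (fst_le (hr' ⟨(s, b), hs⟩ p.1.1)) (snd_le hm))))).trans
        (Set.subset_iUnion (fun q : x.graph => prod q.1.2 (eq p.1.1.collapse q.1.1.collapse))
          ⟨(s, b), hs⟩)
  · intro s b hs
    refine lam_le fun a ha => app_le (a := mem s.collapse y.collapse) ?_
      (app_le ((fst_le (app_le (h _ _) hf)).trans (iInf_le _ (⟨(s, b), hs⟩ : x.graph))) ha)
    rw [mem_collapse]
    refine le_imp_of_cover (fun r hr => Set.mem_iUnion.1 hr) fun q => lam_le fun m hm => ?_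
    exact memIntro_le q.2 (fst_le (app_le (h _ _) hm)) (symm_le
      (app_le (snd_le (hr' ⟨(s, b), hs⟩ q.1.1)) (snd_le (app_le (h _ _) hm))))
  · intro s b hs
    refine lam_le fun a ha => app_le (a := mem s.collapse x.collapse) ?_
      (app_le ((snd_le (app_le (h _ _) hf)).trans (iInf_le _ (⟨(s, b), hs⟩ : y.graph))) ha)
    rw [mem_collapse]
    refine le_imp_of_cover (fun r hr => Set.mem_iUnion.1 hr) fun q => lam_le fun m hm => ?_
    exact memIntro_le q.2 (fst_le (app_le (h _ _) hm)) (app_le (snd_le (hr' q s))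
      (app_le (hsymm _ _) (snd_le (app_le (h _ _) hm))))

variable (R) in
theorem exists_mem_equiv : ∃ c ∈ (alg R).sep, ∀ x y : Name (Set R), c ≤ (alg R).times
    ((alg R).imp ((alg R).memW x y) (mem x.collapse y.collapse))
    ((alg R).imp (mem x.collapse y.collapse) ((alg R).memW x y)) := by
  obtain ⟨c, hc, h⟩ := exists_prod_imp_times R
  obtain ⟨d, hd, h'⟩ := exists_times_imp_prod R
  obtain ⟨e, he, heq⟩ := exists_eq_equiv R
  have := Fact.mk hc
  have := Fact.mk hd
  have := Fact.mk he
  refine ⟨(alg R).pair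
      ((alg R).lam fun t => (alg R).app t ((alg R).lam fun m => (alg R).app d ((alg R).pair
        ((alg R).fst m) ((alg R).app ((alg R).fst e) ((alg R).symm ((alg R).snd m))))))
      ((alg R).lam fun m => (alg R).exIntro ((alg R).pair ((alg R).fst ((alg R).app c m))
        ((alg R).symm ((alg R).app ((alg R).snd e) ((alg R).snd ((alg R).app c m)))))),
    mem_sep_of_tracked inferInstance, fun x y => ?_⟩
  rw [mem_collapse]
  refine pair_le (lam_le fun t ht => memElim_le ht fun s b hs m hm => ?_)
    (le_imp_of_cover (fun r hr => Set.mem_iUnion.1 hr) fun q => lam_le fun m hm => ?_)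
  · exact (app_le (h' _ _) (pair_le (fst_le hm) (app_le (fst_le (heq x s))
      (symm_le (snd_le hm))))).trans
        (Set.subset_iUnion (fun q : y.graph => prod q.1.2 (eq x.collapse q.1.1.collapse))
          ⟨(s, b), hs⟩)
  · exact memIntro_le q.2 (fst_le (app_le (h _ _) hm)) (symm_le
      (app_le (snd_le (heq x q.1.1)) (snd_le (app_le (h _ _) hm))))

/-- Both directions at once, since an implication needs the converse for its antecedent. -/
theorem exists_interp_equiv (κ : Cardinal.{u}) {n : ℕ} (φ : Fml n) :
    (∃ c ∈ (alg R).sep, ∀ α : Fin n → W (Set R) κ, c ≤ (alg R).imp ((alg R).interp κ φ α)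
      (interp κ φ fun i => toV κ (α i))) ∧
    ∃ d ∈ (alg R).sep, ∀ α : Fin n → W (Set R) κ, d ≤ (alg R).imp
      (interp κ φ fun i => toV κ (α i)) ((alg R).interp κ φ α) := by
  induction φ with
  | bot => exact ⟨⟨(alg R).lam fun t => t, mem_sep_of_tracked inferInstance,
      fun α => lam_le fun t ht => ht⟩, ⟨(alg R).lam fun t => t, mem_sep_of_tracked inferInstance,
      fun α => lam_le fun t ht => ht⟩⟩
  | mem i j =>
    obtain ⟨c, hc, h⟩ := exists_mem_equiv R
    have := Fact.mk hc
    exact ⟨⟨(alg R).fst c, mem_sep_of_tracked inferInstance, fun α => fst_le (h _ _)⟩,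
      ⟨(alg R).snd c, mem_sep_of_tracked inferInstance, fun α => snd_le (h _ _)⟩⟩
  | eq i j =>
    obtain ⟨c, hc, h⟩ := exists_eq_equiv R
    have := Fact.mk hc
    exact ⟨⟨(alg R).fst c, mem_sep_of_tracked inferInstance, fun α => fst_le (h _ _)⟩,
      ⟨(alg R).snd c, mem_sep_of_tracked inferInstance, fun α => snd_le (h _ _)⟩⟩
  | and φ ψ ihφ ihψ =>
    obtain ⟨⟨c, hc, h⟩, ⟨d, hd, h'⟩⟩ := ihφ
    obtain ⟨⟨c₁, hc₁, h₁⟩, ⟨d₁, hd₁, h₁'⟩⟩ := ihψ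
    obtain ⟨p, hp, hprod⟩ := exists_prod_imp_times R
    obtain ⟨q, hq, hprod'⟩ := exists_times_imp_prod R
    have := Fact.mk hc
    have := Fact.mk hd
    have := Fact.mk hc₁
    have := Fact.mk hd₁
    have := Fact.mk hp
    have := Fact.mk hq
    exact ⟨⟨(alg R).lam fun t => (alg R).app q ((alg R).pair ((alg R).app c ((alg R).fst t))
        ((alg R).app c₁ ((alg R).snd t))), mem_sep_of_tracked inferInstance,
        fun α => lam_le fun t ht => app_le (hprod' _ _)
          (pair_le (app_le (h α) (fst_le ht)) (app_le (h₁ α) (snd_le ht)))⟩,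
      ⟨(alg R).lam fun t => (alg R).pair ((alg R).app d ((alg R).fst ((alg R).app p t)))
        ((alg R).app d₁ ((alg R).snd ((alg R).app p t))), mem_sep_of_tracked inferInstance,
        fun α => lam_le fun t ht => pair_le (app_le (h' α) (fst_le (app_le (hprod _ _) ht)))
          (app_le (h₁' α) (snd_le (app_le (hprod _ _) ht)))⟩⟩
  | or φ ψ ihφ ihψ =>
    obtain ⟨⟨c, hc, h⟩, ⟨d, hd, h'⟩⟩ := ihφ
    obtain ⟨⟨c₁, hc₁, h₁⟩, ⟨d₁, hd₁, h₁'⟩⟩ := ihψ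
    obtain ⟨p, hp, hsum⟩ := exists_sum_imp_plus R
    obtain ⟨q, hq, hsum'⟩ := exists_plus_imp_sum R
    have := Fact.mk hc
    have := Fact.mk hd
    have := Fact.mk hc₁
    have := Fact.mk hd₁
    have := Fact.mk hp
    have := Fact.mk hq
    exact ⟨⟨(alg R).lam fun t => (alg R).app q ((alg R).app ((alg R).app t
          ((alg R).lam fun a => (alg R).inl ((alg R).app c a)))
          ((alg R).lam fun b => (alg R).inr ((alg R).app c₁ b))), mem_sep_of_tracked inferInstance,
        fun α => lam_le fun t ht => app_le (hsum' _ _) (case_le ht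
          (lam_le fun a ha => inl_le (app_le (h α) ha))
          (lam_le fun b hb => inr_le (app_le (h₁ α) hb)))⟩,
      ⟨(alg R).lam fun t => (alg R).app ((alg R).app ((alg R).app p t)
          ((alg R).lam fun a => (alg R).inl ((alg R).app d a)))
          ((alg R).lam fun b => (alg R).inr ((alg R).app d₁ b)), mem_sep_of_tracked inferInstance,
        fun α => lam_le fun t ht => case_le (app_le (hsum _ _) ht)
          (lam_le fun a ha => inl_le (app_le (h' α) ha))
          (lam_le fun b hb => inr_le (app_le (h₁' α) hb))⟩⟩
  | imp φ ψ ihφ ihψ =>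
    obtain ⟨⟨c, hc, h⟩, ⟨d, hd, h'⟩⟩ := ihφ
    obtain ⟨⟨c₁, hc₁, h₁⟩, ⟨d₁, hd₁, h₁'⟩⟩ := ihψ
    have := Fact.mk hc
    have := Fact.mk hd
    have := Fact.mk hc₁
    have := Fact.mk hd₁
    exact ⟨⟨(alg R).lam fun t => (alg R).lam fun a =>
          (alg R).app c₁ ((alg R).app t ((alg R).app d a)), mem_sep_of_tracked inferInstance,
        fun α => lam_le fun t ht => lam_le fun a ha =>
          app_le (h₁ α) (app_le ht (app_le (h' α) ha))⟩,
      ⟨(alg R).lam fun t => (alg R).lam fun a =>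
          (alg R).app d₁ ((alg R).app t ((alg R).app c a)), mem_sep_of_tracked inferInstance,
        fun α => lam_le fun t ht => lam_le fun a ha =>
          app_le (h₁' α) (app_le ht (app_le (h α) ha))⟩⟩
  | ex φ ih =>
    obtain ⟨⟨c, hc, h⟩, ⟨d, hd, h'⟩⟩ := ih
    have := Fact.mk hc
    have := Fact.mk hd
    refine ⟨⟨(alg R).lam fun t => (alg R).app t ((alg R).lam fun a => (alg R).app c a),
        mem_sep_of_tracked inferInstance, fun α => lam_le fun t ht => exElim_le ht fun β =>
          lam_le fun a ha => (app_le (h _) ha).trans ?_⟩,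
      ⟨(alg R).lam fun t => (alg R).exIntro ((alg R).app d t), mem_sep_of_tracked inferInstance,
        fun α => ?_⟩⟩
    · rw [toV_snoc]
      exact fun r hr => ⟨_, hr⟩
    · refine le_imp_of_cover (fun r hr => hr) fun v => lam_le fun t ht => ?_
      obtain ⟨β, rfl⟩ := toV_surjective κ v
      rw [← toV_snoc] at ht
      exact exIntro_le β (app_le (h' _) ht)
  | all φ ih =>
    obtain ⟨⟨c, hc, h⟩, ⟨d, hd, h'⟩⟩ := ih
    have := Fact.mk hc
    have := Fact.mk hd
    refine ⟨⟨(alg R).lam fun t => (alg R).app c t, mem_sep_of_tracked inferInstance,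
        fun α => lam_le fun t ht r hr v => ?_⟩,
      ⟨(alg R).lam fun t => (alg R).app d t, mem_sep_of_tracked inferInstance,
        fun α => lam_le fun t ht => le_iInf fun β => app_le (h' _) (ht.trans ?_)⟩⟩
    · obtain ⟨β, rfl⟩ := toV_surjective κ v
      rw [← toV_snoc]
      exact app_le (h _) (ht.trans (iInf_le _ β)) hr
    · rw [toV_snoc]
      exact fun r hr => hr _

end Realizability

theorem mainTheorem1 (κ : Cardinal.{u}) (hκ : κ.IsInaccessible) :
    -- the implicative-valued model validates every axiom of IZF
    (∀ (A : Type u) [CompleteLattice A] (𝔸 : ImplicativeAlgebra A), #A < κ →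
      ∀ ψ : Fml 0, IZFAxiom ψ → 𝔸.interp κ ψ ![] ∈ 𝔸.sep) ∧
    -- for a complete Heyting algebra, the interpretation is the Heyting-valued one
    (∀ (H : Type u) [Order.Frame H], #H < κ →
      ∀ (n : ℕ) (φ : Fml n) (α : Fin n → W H κ),
        (heytingImplicative H).interp κ φ α = HeytingValued.interp κ φ α) ∧
    -- for a total combinatory algebra, the interpretation is the realizability one, through the
    -- surjection that reads a partial function `f` as the set of pairs `(t, r)` with `r ∈ f(t)`
    (∀ (R : Type u) [CombinatoryAlgebra R], #(Set R) < κ →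
      ∃ T : W (Set R) κ → Realizability.V R κ, Function.Surjective T ∧
        (∀ (f : W (Set R) κ) (p : Name R × R), p ∈ (T f).1.graph ↔
          ∃ (t : W (Set R) κ) (X : Set R),
            (t.1, X) ∈ f.1.graph ∧ p.2 ∈ X ∧ p.1 = (T t).1) ∧
        ∀ (n : ℕ) (φ : Fml n),
          (⨅ α : Fin n → W (Set R) κ, (realizabilityImplicative R).imp
            ((realizabilityImplicative R).interp κ φ α)
            (Realizability.interp κ φ fun i => T (α i))) ∈ (realizabilityImplicative R).sep ∧
          (⨅ α : Fin n → W (Set R) κ, (realizabilityImplicative R).imp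
            (Realizability.interp κ φ fun i => T (α i))
            ((realizabilityImplicative R).interp κ φ α)) ∈ (realizabilityImplicative R).sep) := by
  refine ⟨fun A _ 𝔸 hA ψ hψ => ImplicativeAlgebra.interp_mem_sep_of_izfAxiom hκ hA hψ,
    fun H _ _ n φ α => HeytingValued.interp_eq φ α, fun R _ _ => ?_⟩
  refine ⟨Realizability.toV κ, Realizability.toV_surjective κ, fun f p => ?_, fun n φ => ?_⟩
  · refine Name.mem_graph_collapse.trans ⟨?_, ?_⟩
    · rintro ⟨t, X, ht, hp, hp'⟩
      exact ⟨⟨t, f.mem_of_graph ht⟩, X, ht, hp, hp'⟩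
    · rintro ⟨t, X, ht, hp, hp'⟩
      exact ⟨t.1, X, ht, hp, hp'⟩
  · obtain ⟨⟨c, hc, h⟩, ⟨d, hd, h'⟩⟩ := Realizability.exists_interp_equiv (R := R) κ φ
    exact ⟨(realizabilityImplicative R).sep_upward hc (le_iInf h),
      (realizabilityImplicative R).sep_upward hd (le_iInf h')⟩
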